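/- **NNGP correspondence for linear ResGCN.** Let $\mathcal G$ be an undirected graph on $n$ nodes with adjacency matrix $A$ and degree matrix $D$, and let $\hat A=(D+I)^{-1/2}(A+I)(D+I)^{-1/2}$. Let $X\in\mathbb R^{n\times d_0}$ be a fixed feature matrix, let $\alpha,\beta,\sigma_w\in\mathbb R$, and let $L\ge 0$ be a depth. The linear ResGCN of hidden width $d$ (identity activation, biases initialized to $0$) is $$X^{(0)}=XW^{(0)},\qquad H^{(l)}=\hat A X^{(l-1)}W^{(l)},\qquad X^{(l)}=\alpha H^{(l)}+\beta X^{(l-1)}\qquad(1\le l\le L),$$ with $W^{(0)}\in\mathbb R^{d_0\times d}$ and $W^{(l)}\in\mathbb R^{d\times d}$ for $l\ge1$. At initialization, for each width $d$, all entries of $W^{(0)},\dots,W^{(L)}$ are independent, the entries of $\sqrt{d_0}\,W^{(0)}$ have law $\nu_0$, and the entries of $\sqrt d\,W^{(l)}$ have law $\nu_l$ $(1\le l\le L)$, where $\nu_0,\dots,\nu_L$ are probability laws on $\mathbb R$ that do not depend on $d$ and have mean $0$ and variance $\sigma_w^2$. We say that the channels (columns) $\{Y^{(d)}_{:,k}\}_{k\in[d]}$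 of random matrices $Y^{(d)}\in\mathbb R^{n\times d}$ converge in distribution to i.i.d. random vectors of law $\rho$ as $d\to\infty$ if, for every fixed $m$ and every choice, at each width $d\ge m$, of $m$ distinct channels, the joint law of the $m$ chosen channels converges weakly to $\rho^{\otimes m}$. Then, as $d\to\infty$: 1. For every $1\le l\le L$, the pre-activation channels $\{H^{(l)}_{:,k}\}_{k\in[d]}$ converge in distribution to i.i.d. Gaussian vectors $N(\mathbf 0_n,\tilde\Sigma^{(l)})$, where $$\tilde\Sigma^{(1)}=\frac{\sigma_w^4}{d_0}\hat A XX^{T}\hat A,\qquad \tilde\Sigma^{(l+1)}=\alpha^2\sigma_w^2\,\hat A\tilde\Sigma^{(l)}\hat A+\beta^2\tilde\Sigma^{(l)}.$$ 2. For every $0\le l\le L$, the post-activation channels $\{X^{(l)}_{:,k}\}_{k\in[d]}$ converge in distribution to i.i.d. random vectors whose common law has finite second moment, mean $\mathbf 0_n$ and covariance matrix $\Phi^{(l)}$, where $$\Phi^{(0)}=\frac{\sigma_w^2}{d_0}XX^{T},\qquad \Phi^{(l)}=\alpha^2\sigma_w^2\,\hat A\Phi^{(l-1)}\hat A+\beta^2\Phi^{(l-1)}\quad(l\ge1).$$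 -/

import Mathlib

open MeasureTheory ProbabilityTheory Filter Topology

noncomputable section

namespace ResGCN

/-- The normalized adjacency matrix `D̃^{-1/2} (A + I) D̃^{-1/2}` of an undirected graph, where
`D̃ = D + I` and `D` is the diagonal matrix of degrees. -/
def normAdj {V : Type*} [Fintype V] [DecidableEq V] (G : SimpleGraph V) [DecidableRel G.Adj] :
    Matrix V V ℝ :=
  Matrix.diagonal (fun i => (√((G.degree i : ℝ) + 1))⁻¹) * (G.adjMatrix ℝ + 1) *
    Matrix.diagonal (fun i => (√((G.degree i : ℝ) + 1))⁻¹)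

section Network

variable {V : Type*} [Fintype V] {d₀ d : ℕ}

/-- One graph convolution: `Â Y W + 1ₙ b`. -/
def conv (Ahat : Matrix V V ℝ) (Y : Matrix V (Fin d) ℝ) (W : Matrix (Fin d) (Fin d) ℝ)
    (b : Fin d → ℝ) : Matrix V (Fin d) ℝ :=
  Ahat * Y * W + Matrix.vecMulVec (1 : V → ℝ) b

/-- Post-activation embeddings of the ResGCN of width `d` with activation `act`:
`X⁽⁰⁾ = X W⁽⁰⁾` and `X⁽ˡ⁾ = α act(H⁽ˡ⁾) + β X⁽ˡ⁻¹⁾` with `H⁽ˡ⁾ = Â X⁽ˡ⁻¹⁾ W⁽ˡ⁾ + 1ₙ b⁽ˡ⁾`.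
The weight `W⁽⁰⁾` is `W0`, and `W⁽ˡ⁾`, `b⁽ˡ⁾` for `l ≥ 1` are `W l`, `b l`
(`W 0` and `b 0` are not used). -/
def postAct (Ahat : Matrix V V ℝ) (X : Matrix V (Fin d₀) ℝ) (α β : ℝ) (act : ℝ → ℝ)
    (W0 : Matrix (Fin d₀) (Fin d) ℝ) (W : ℕ → Matrix (Fin d) (Fin d) ℝ) (b : ℕ → Fin d → ℝ) :
    ℕ → Matrix V (Fin d) ℝ
  | 0 => X * W0
  | l + 1 =>
      α • (conv Ahat (postAct Ahat X α β act W0 W b l) (W (l + 1)) (b (l + 1))).map act +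
        β • postAct Ahat X α β act W0 W b l

/-- Pre-activation embeddings `H⁽ˡ⁾ = Â X⁽ˡ⁻¹⁾ W⁽ˡ⁾ + 1ₙ b⁽ˡ⁾` for `l ≥ 1`; there is no
layer `0`, and the value there is a placeholder. -/
def preAct (Ahat : Matrix V V ℝ) (X : Matrix V (Fin d₀) ℝ) (α β : ℝ) (act : ℝ → ℝ)
    (W0 : Matrix (Fin d₀) (Fin d) ℝ) (W : ℕ → Matrix (Fin d) (Fin d) ℝ) (b : ℕ → Fin d → ℝ) :
    ℕ → Matrix V (Fin d) ℝ
  | 0 => 0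
  | l + 1 => conv Ahat (postAct Ahat X α β act W0 W b l) (W (l + 1)) (b (l + 1))

/-- The `k`-th channel (column) of an embedding matrix, as a vector of `ℝⁿ`. -/
def channel (M : Matrix V (Fin d) ℝ) (k : Fin d) : EuclideanSpace ℝ V :=
  WithLp.toLp 2 fun i => M i k

/-- The covariance matrices `Σ̃⁽ˡ⁾`, `l ≥ 1` (the value at `0` is a placeholder). -/
def preCov (Ahat : Matrix V V ℝ) (X : Matrix V (Fin d₀) ℝ) (α β σw : ℝ) : ℕ → Matrix V V ℝ
  | 0 => 0
  | 1 => (σw ^ 4 / (d₀ : ℝ)) • (Ahat * X * X.transpose * Ahat)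
  | l + 2 => (α ^ 2 * σw ^ 2) • (Ahat * preCov Ahat X α β σw (l + 1) * Ahat) +
      β ^ 2 • preCov Ahat X α β σw (l + 1)

/-- The covariance matrices `Φ⁽ˡ⁾`, `l ≥ 0`. -/
def postCov (Ahat : Matrix V V ℝ) (X : Matrix V (Fin d₀) ℝ) (α β σw : ℝ) : ℕ → Matrix V V ℝ
  | 0 => (σw ^ 2 / (d₀ : ℝ)) • (X * X.transpose)
  | l + 1 => (α ^ 2 * σw ^ 2) • (Ahat * postCov Ahat X α β σw l * Ahat) +
      β ^ 2 • postCov Ahat X α β σw l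

end Network

/-- Random initialization of the weights `W⁽⁰⁾, …, W⁽ᴸ⁾` of a ResGCN of width `d`: all entries of
all these matrices are independent, and each entry of `W⁽ˡ⁾`, multiplied by the square root of the
number of rows of `W⁽ˡ⁾`, has law `ν l`. -/
structure IsRandomInit {Ω : Type*} [MeasurableSpace Ω] (P : Measure Ω) {d₀ d : ℕ} (L : ℕ)
    (ν : ℕ → Measure ℝ) (W0 : Ω → Matrix (Fin d₀) (Fin d) ℝ)
    (W : ℕ → Ω → Matrix (Fin d) (Fin d) ℝ) : Prop where
  law_zero : ∀ i k, HasLaw (fun ω => √(d₀ : ℝ) * W0 ω i k) (ν 0) P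
  law_hidden : ∀ l, 1 ≤ l → l ≤ L → ∀ j k, HasLaw (fun ω => √(d : ℝ) * W l ω j k) (ν l) P
  indep : iIndepFun
    (Sum.elim (fun (p : Fin d₀ × Fin d) (ω : Ω) => W0 ω p.1 p.2)
      (fun (q : Fin L × Fin d × Fin d) (ω : Ω) => W (q.1 + 1) ω q.2.1 q.2.2)) P

/-- For each width `d` let `C d k`, `k < d`, be random vectors on a probability space
`(Ω d, P d)`. As `d → ∞` they converge in distribution to i.i.d. random vectors of law `ρ`: for
every `m`, the joint law of any `m` distinct channels (however they are selected at each width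
`m + d`) converges weakly to the `m`-fold product of `ρ`. -/
def ConvergeIID {E : Type*} [TopologicalSpace E] [SecondCountableTopology E] [MeasurableSpace E]
    [BorelSpace E] {Ω : ℕ → Type*} [∀ d, MeasurableSpace (Ω d)] (P : ∀ d, Measure (Ω d))
    [∀ d, IsProbabilityMeasure (P d)] (C : ∀ d, Fin d → Ω d → E) (ρ : Measure E)
    [IsProbabilityMeasure ρ] : Prop :=
  ∀ (m : ℕ) (e : ∀ d, Fin m ↪ Fin (m + d)),
    TendstoInDistribution (fun d (ω : Ω (m + d)) (j : Fin m) => C (m + d) (e d j) ω) atTop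
      id (fun d => P (m + d)) (Measure.pi fun _ : Fin m => ρ)

end ResGCN

end

noncomputable section

namespace ResGCN

set_option linter.unusedSectionVars false

/-! The argument is an induction on depth built on a conditional central limit theorem. Given the
embedding at layer `l`, with channels `x_j`, the next pre-activation channels are `∑ j, w j k • Â
x_j` with fresh weights. They are conditionally independent over `k`, with conditional
characteristic function `∏ j, φ(⟨Â x_j, t⟩ / √d)`, where `φ` is the characteristic function of the
weight law. Since `φ(s) = exp(-σ²s²/2) + o(s²)`, this product is close to `exp(-(σ²/2) · d⁻¹ ∑ j, ⟨Â
x_j, t⟩²)`. If the empirical average converges to a constant, the limit is Gaussian and does not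
depend on the conditioning. So the new channels become Gaussian, independent of each other and of
the channels of layer `l` carried by the residual branch.

The channels `x_j` are dependent at finite width, so the law of large numbers comes from the
induction hypothesis: joint convergence of pairs makes bounded functions of distinct channels
asymptotically uncorrelated. To pass to the unbounded function `⟨Â x, t⟩²` one needs uniform
integrability, and only second moments are available. The key fact is that second moments obey the
covariance recursion exactly at every width (`postAct_moments`), so they equal those of the limit
law. Weak convergence together with equality of these moments gives uniform smallness of truncation
errors (`ConvergeIID.exists_eventually_integral_sub_trunc_le`), hence the `L¹` law of large numbers
and the Lindeberg estimate.

`ConvergeIID.tendsto_charFun_layer` assembles these into joint convergence of old and new channels,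
and `convergeIID_layer` reads off both conclusions. The limit law of the post-activations need not
be Gaussian, because `X⁽⁰⁾` is a combination of only `d₀` weights; only its first two moments are
tracked. -/

/-! ### Second-order expansion of characteristic functions. -/

lemma norm_prod_sub_prod_le_sum {ι : Type*} (s : Finset ι) (f g : ι → ℂ)
    (hf : ∀ i ∈ s, ‖f i‖ ≤ 1) (hg : ∀ i ∈ s, ‖g i‖ ≤ 1) :
    ‖∏ i ∈ s, f i - ∏ i ∈ s, g i‖ ≤ ∑ i ∈ s, ‖f i - g i‖ := by
  classical
  induction s using Finset.induction with
  | empty => simp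
  | insert a s ha ih =>
    rw [Finset.prod_insert ha, Finset.prod_insert ha, Finset.sum_insert ha]
    have h1 : ‖∏ i ∈ s, f i‖ ≤ 1 := by
      rw [norm_prod]
      exact Finset.prod_le_one (fun _ _ => norm_nonneg _)
        fun i hi => hf i (Finset.mem_insert_of_mem hi)
    have h2 := ih (fun i hi => hf i (Finset.mem_insert_of_mem hi))
      (fun i hi => hg i (Finset.mem_insert_of_mem hi))
    calc ‖f a * ∏ i ∈ s, f i - g a * ∏ i ∈ s, g i‖
        = ‖(f a - g a) * ∏ i ∈ s, f i + g a * (∏ i ∈ s, f i - ∏ i ∈ s, g i)‖ := by ring_nf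
      _ ≤ ‖f a - g a‖ * ‖∏ i ∈ s, f i‖ + ‖g a‖ * ‖∏ i ∈ s, f i - ∏ i ∈ s, g i‖ := by
          rw [← norm_mul, ← norm_mul]; exact norm_add_le _ _
      _ ≤ ‖f a - g a‖ * 1 + 1 * ∑ i ∈ s, ‖f i - g i‖ := by
          gcongr
          exact hg a (Finset.mem_insert_self _ _)
      _ = _ := by ring

/-- Two laws with the same first two moments have characteristic functions that agree to second
order at `0`. -/
lemma charFun_sub_charFun_isLittleO {μ ν : Measure ℝ} [IsProbabilityMeasure μ]
    [IsProbabilityMeasure ν] (hμ : MemLp id 2 μ) (hν : MemLp id 2 ν)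
    (h1 : ∫ x, x ∂μ = ∫ x, x ∂ν) (h2 : ∫ x, x ^ 2 ∂μ = ∫ x, x ^ 2 ∂ν) :
    (fun t : ℝ => charFun μ t - charFun ν t) =o[𝓝 0] fun t : ℝ => t ^ 2 := by
  have key : ∀ {κ : Measure ℝ} [IsProbabilityMeasure κ], MemLp id 2 κ →
      (fun t : ℝ => charFun κ t - taylorWithinEval (charFun κ) 2 Set.univ 0 t)
        =o[𝓝 0] fun t : ℝ => t ^ 2 := by
    intro κ _ hκ
    have := taylor_isLittleO_univ (x₀ := 0) (n := 2) (contDiff_charFun (n := 2) (μ := κ)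
      (by exact_mod_cast hκ))
    simpa using this
  have heq : ∀ t : ℝ, taylorWithinEval (charFun μ) 2 Set.univ 0 t
      = taylorWithinEval (charFun ν) 2 Set.univ 0 t := by
    intro t
    rw [taylorWithinEval_charFun_zero (n := 2) (by exact_mod_cast hμ),
      taylorWithinEval_charFun_zero (n := 2) (by exact_mod_cast hν)]
    simp [Finset.sum_range_succ, h1, h2]
  refine ((key hμ).sub (key hν)).congr_left fun t => ?_
  rw [heq t]; ring

/-- The exponential is the characteristic function of the centered Gaussian law of variance `σ ^ 2`,
which shares its first two moments with `ν`. -/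
lemma charFun_sub_exp_le {ν : Measure ℝ} [IsProbabilityMeasure ν] (hν : MemLp id 2 ν)
    (h1 : ∫ x, x ∂ν = 0) {σ : ℝ} (h2 : variance id ν = σ ^ 2) {ε : ℝ} (hε : 0 < ε) :
    ∃ δ > 0, ∀ s : ℝ, |s| ≤ δ → ‖charFun ν s - Complex.exp (-(σ ^ 2 * s ^ 2 / 2) : ℝ)‖ ≤ ε * s ^ 2 := by
  set g := gaussianReal 0 (σ ^ 2).toNNReal with hg
  have hgm : MemLp id 2 g := memLp_id_gaussianReal 2
  have hg1 : ∫ x, x ∂g = 0 := by simp [hg, integral_id_gaussianReal]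
  have hg2 : variance id g = σ ^ 2 := by
    rw [hg, variance_id_gaussianReal, Real.coe_toNNReal _ (sq_nonneg σ)]
  have hsq : ∀ {κ : Measure ℝ} [IsProbabilityMeasure κ], MemLp id 2 κ → ∫ x, x ∂κ = 0 →
      variance id κ = σ ^ 2 → ∫ x, x ^ 2 ∂κ = σ ^ 2 := by
    intro κ _ hκ hκ1 hκ2
    rw [variance_eq_sub hκ] at hκ2
    simpa [hκ1] using hκ2
  have ho := charFun_sub_charFun_isLittleO hν hgm (h1.trans hg1.symm)
    ((hsq hν h1 h2).trans (hsq hgm hg1 hg2).symm)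
  have := ho.bound hε
  obtain ⟨δ, hδ, hball⟩ := Metric.eventually_nhds_iff.1 this
  -- Halving turns the open ball of radius `δ` into a closed condition on `|s|`.
  refine ⟨δ / 2, by positivity, fun s hs => ?_⟩
  have h := hball (y := s) (by rw [Real.dist_eq, sub_zero]; linarith)
  rw [Real.norm_of_nonneg (sq_nonneg s)] at h
  convert h using 3
  rw [hg, charFun_gaussianReal, Real.coe_toNNReal _ (sq_nonneg σ)]
  simp

/-! ### A law of large numbers for asymptotically i.i.d. channels. -/

section Converge

variable {E : Type*} [MeasurableSpace E] {Ω : ℕ → Type*} [∀ d, MeasurableSpace (Ω d)]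
  {P : ∀ d, Measure (Ω d)} [∀ d, IsProbabilityMeasure (P d)] {C : ∀ d, Fin d → Ω d → E}
  {ρ : Measure E} [IsProbabilityMeasure ρ]

section Top
variable [TopologicalSpace E] [SecondCountableTopology E] [BorelSpace E]

/-- `ConvergeIID` allows the selected channels to vary arbitrarily with the width, so convergence is
automatically uniform over selections: a worst selection at each width is itself admissible. -/
theorem ConvergeIID.eventually_abs_integral_sub_lt (h : ConvergeIID P C ρ) {m : ℕ}
    (F : BoundedContinuousFunction (Fin m → E) ℝ) {ε : ℝ} (hε : 0 < ε) :
    ∀ᶠ d in atTop, ∀ e : Fin m ↪ Fin d,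
      |∫ ω, F (fun j => C d (e j) ω) ∂P d - ∫ y, F y ∂(Measure.pi fun _ : Fin m => ρ)| < ε := by
  suffices hs : ∀ᶠ d in atTop, ∀ e : Fin m ↪ Fin (m + d),
      |∫ ω, F (fun j => C (m + d) (e j) ω) ∂P (m + d)
        - ∫ y, F y ∂(Measure.pi fun _ : Fin m => ρ)| < ε by
    obtain ⟨N, hN⟩ := eventually_atTop.1 hs
    refine eventually_atTop.2 ⟨m + N, fun d hd => ?_⟩
    obtain ⟨d', rfl⟩ := Nat.exists_eq_add_of_le (show m ≤ d by omega)
    exact hN d' (by omega)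
  classical
  -- A violating selection wherever one exists; the value elsewhere is irrelevant. Convergence along
  -- `e` shows that eventually none exists.
  let e : ∀ d, Fin m ↪ Fin (m + d) := fun d =>
    if hd : ∃ e : Fin m ↪ Fin (m + d), ¬ |∫ ω, F (fun j => C (m + d) (e j) ω) ∂P (m + d)
        - ∫ y, F y ∂(Measure.pi fun _ : Fin m => ρ)| < ε then hd.choose else Fin.castAddEmb d
  have ht := h m e
  have h1 := (ProbabilityMeasure.tendsto_iff_forall_integral_tendsto.1 ht.tendsto) F
  have h2 := (Metric.tendsto_nhds.1 h1) ε hε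
  filter_upwards [h2] with d hd
  rw [Real.dist_eq] at hd
  simp only [ProbabilityMeasure.coe_mk, Measure.map_id] at hd
  rw [integral_map (ht.forall_aemeasurable d) F.continuous.aestronglyMeasurable] at hd
  by_contra hcon
  push Not at hcon
  have hex : ∃ e : Fin m ↪ Fin (m + d), ¬ |∫ ω, F (fun j => C (m + d) (e j) ω) ∂P (m + d)
        - ∫ y, F y ∂(Measure.pi fun _ : Fin m => ρ)| < ε := by
    obtain ⟨e', he'⟩ := hcon
    exact ⟨e', not_lt.2 he'⟩
  have he : e d = hex.choose := dif_pos hex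
  rw [he] at hd
  exact hex.choose_spec hd

theorem ConvergeIID.eventually_abs_integral_sub_lt_one (h : ConvergeIID P C ρ)
    (f : BoundedContinuousFunction E ℝ) {ε : ℝ} (hε : 0 < ε) :
    ∀ᶠ d in atTop, ∀ j : Fin d, |∫ ω, f (C d j ω) ∂P d - ∫ y, f y ∂ρ| < ε := by
  have := h.eventually_abs_integral_sub_lt (m := 1)
    (f.compContinuous ⟨fun y => y 0, continuous_apply 0⟩) hε
  filter_upwards [this] with d hd j
  have h1 : |∫ ω, f (C d j ω) ∂P d - ∫ y : Fin 1 → E, f (y 0) ∂(Measure.pi fun _ => ρ)| < ε :=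
    hd ⟨fun _ => j, fun a b _ => Subsingleton.elim a b⟩
  have h2 : ∫ y : Fin 1 → E, f (y 0) ∂(Measure.pi fun _ : Fin 1 => ρ) = ∫ y, f y ∂ρ := by
    have hmp := measurePreserving_eval (μ := fun _ : Fin 1 => ρ) 0
    rw [← integral_map hmp.measurable.aemeasurable f.continuous.aestronglyMeasurable, hmp.map_eq]
  simpa [h2] using h1

/-- Under the limit law `ρ ⊗ ρ` of a pair the expectation factors and vanishes. Distinctness of `j`
and `k` is what makes `![j, k]` a selection. -/
theorem ConvergeIID.eventually_abs_integral_mul_lt (h : ConvergeIID P C ρ)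
    (f : BoundedContinuousFunction E ℝ) (hf : ∫ y, f y ∂ρ = 0) {ε : ℝ} (hε : 0 < ε) :
    ∀ᶠ d in atTop, ∀ j k : Fin d, j ≠ k → |∫ ω, f (C d j ω) * f (C d k ω) ∂P d| < ε := by
  have := h.eventually_abs_integral_sub_lt (m := 2)
    (f.compContinuous ⟨fun y => y 0, continuous_apply 0⟩ *
      f.compContinuous ⟨fun y => y 1, continuous_apply 1⟩) hε
  filter_upwards [this] with d hd j k hjk
  have h1 : |∫ ω, f (C d j ω) * f (C d k ω) ∂P d
      - ∫ y : Fin 2 → E, f (y 0) * f (y 1) ∂(Measure.pi fun _ => ρ)| < ε := hd ⟨![j, k], by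
    intro a b hab
    fin_cases a <;> fin_cases b <;> simp_all [hjk.symm]⟩
  have h2 : ∫ y : Fin 2 → E, f (y 0) * f (y 1) ∂(Measure.pi fun _ : Fin 2 => ρ) = 0 := by
    have := integral_fintype_prod_eq_prod (𝕜 := ℝ) (μ := fun _ : Fin 2 => ρ) (fun _ => (f : E → ℝ))
    simp only [Fin.prod_univ_two] at this
    rw [this, hf, zero_mul]
  simpa [h2] using h1

end Top
end Converge

section Converge

variable {E : Type*} [MeasurableSpace E] {Ω : ℕ → Type*} [∀ d, MeasurableSpace (Ω d)]
  {P : ∀ d, Measure (Ω d)} [∀ d, IsProbabilityMeasure (P d)] {C : ∀ d, Fin d → Ω d → E}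
  {ρ : Measure E} [IsProbabilityMeasure ρ]
  [TopologicalSpace E] [SecondCountableTopology E] [BorelSpace E]

lemma integrable_boundedContinuous_comp (hC : ∀ d j, AEMeasurable (C d j) (P d))
    (f : BoundedContinuousFunction E ℝ) (d : ℕ) (j : Fin d) :
    Integrable (fun ω => f (C d j ω)) (P d) :=
  Integrable.of_bound (f.continuous.measurable.comp_aemeasurable (hC d j)).aestronglyMeasurable
    ‖f‖ (ae_of_all _ fun _ => f.norm_coe_le_norm _)

lemma integrable_boundedContinuous_mul_comp (hC : ∀ d j, AEMeasurable (C d j) (P d))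
    (f : BoundedContinuousFunction E ℝ) (d : ℕ) (j k : Fin d) :
    Integrable (fun ω => f (C d j ω) * f (C d k ω)) (P d) :=
  (integrable_boundedContinuous_comp hC f d k).bdd_mul
    (integrable_boundedContinuous_comp hC f d j).aestronglyMeasurable
    (ae_of_all _ fun _ => f.norm_coe_le_norm _)

theorem ConvergeIID.eventually_integral_sq_average_le (h : ConvergeIID P C ρ)
    (hC : ∀ d j, AEMeasurable (C d j) (P d))
    (f : BoundedContinuousFunction E ℝ) (hf : ∫ y, f y ∂ρ = 0) {ε : ℝ} (hε : 0 < ε) :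
    ∀ᶠ d : ℕ in atTop, ∫ ω, ((d : ℝ)⁻¹ * ∑ j, f (C d j ω)) ^ 2 ∂P d ≤ ε := by
  have hlim : Tendsto (fun d : ℕ => ‖f‖ ^ 2 * (d : ℝ)⁻¹) atTop (𝓝 0) := by
    simpa using tendsto_inv_atTop_nhds_zero_nat.const_mul (‖f‖ ^ 2)
  filter_upwards [h.eventually_abs_integral_mul_lt f hf (half_pos hε), eventually_gt_atTop 0,
    hlim.eventually_lt_const (half_pos hε)] with d hd hd0 hdB
  have hd0' : (0 : ℝ) < d := by exact_mod_cast hd0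
  -- In the expanded square, the `d` diagonal terms are only bounded, but they are negligible
  -- against `d ^ 2`; the off-diagonal ones are individually small.
  have hB : ∀ j k : Fin d, ∫ ω, f (C d j ω) * f (C d k ω) ∂P d
      ≤ ε / 2 + if j = k then ‖f‖ ^ 2 else 0 := by
    intro j k
    by_cases hjk : j = k
    · subst hjk
      have : ∫ ω, f (C d j ω) * f (C d j ω) ∂P d ≤ ∫ _, ‖f‖ ^ 2 ∂P d := by
        refine integral_mono (integrable_boundedContinuous_mul_comp hC f d j j)
          (integrable_const _) fun ω => ?_
        have h1 := f.norm_coe_le_norm (C d j ω)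
        rw [Real.norm_eq_abs] at h1
        have := sq_le_sq' (by linarith [neg_abs_le (f (C d j ω)), h1]) ((le_abs_self _).trans h1)
        simpa [sq] using this
      simp at this
      simp
      linarith
    · simp only [hjk, if_false, add_zero]
      exact (le_abs_self _).trans (hd j k hjk).le
  have heq : ∫ ω, ((d : ℝ)⁻¹ * ∑ j, f (C d j ω)) ^ 2 ∂P d
      = (d : ℝ)⁻¹ ^ 2 * ∑ j, ∑ k, ∫ ω, f (C d j ω) * f (C d k ω) ∂P d := by
    simp_rw [mul_pow, integral_const_mul]
    congr 1
    simp_rw [sq, Finset.sum_mul_sum]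
    rw [integral_finsetSum _ fun j _ => integrable_finsetSum _ fun k _ =>
      integrable_boundedContinuous_mul_comp hC f d j k]
    exact Finset.sum_congr rfl fun j _ => integral_finsetSum _ fun k _ =>
      integrable_boundedContinuous_mul_comp hC f d j k
  rw [heq]
  calc (d : ℝ)⁻¹ ^ 2 * ∑ j, ∑ k, ∫ ω, f (C d j ω) * f (C d k ω) ∂P d
      ≤ (d : ℝ)⁻¹ ^ 2 * ∑ j : Fin d, ∑ k : Fin d, (ε / 2 + if j = k then ‖f‖ ^ 2 else 0) := by
        gcongr with j _ k _
        exact hB j k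
    _ = ε / 2 + ‖f‖ ^ 2 * (d : ℝ)⁻¹ := by
        simp [Finset.sum_add_distrib]
        field_simp
    _ ≤ ε := by linarith

theorem ConvergeIID.eventually_integral_abs_average_le (h : ConvergeIID P C ρ)
    (hC : ∀ d j, AEMeasurable (C d j) (P d))
    (f : BoundedContinuousFunction E ℝ) (hf : ∫ y, f y ∂ρ = 0) {ε : ℝ} (hε : 0 < ε) :
    ∀ᶠ d : ℕ in atTop, ∫ ω, |(d : ℝ)⁻¹ * ∑ j, f (C d j ω)| ∂P d ≤ ε := by
  filter_upwards [h.eventually_integral_sq_average_le hC f hf (pow_pos hε 2)] with d hd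
  have hS : Integrable (fun ω => (d : ℝ)⁻¹ * ∑ j, f (C d j ω)) (P d) :=
    (integrable_finsetSum _ fun j _ => integrable_boundedContinuous_comp hC f d j).const_mul _
  have hS2 : Integrable (fun ω => ((d : ℝ)⁻¹ * ∑ j, f (C d j ω)) ^ 2) (P d) := by
    simp_rw [mul_pow, sq (∑ j, f _), Finset.sum_mul_sum]
    exact (integrable_finsetSum _ fun j _ => integrable_finsetSum _ fun k _ =>
      integrable_boundedContinuous_mul_comp hC f d j k).const_mul _
  calc ∫ ω, |(d : ℝ)⁻¹ * ∑ j, f (C d j ω)| ∂P d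
      ≤ ∫ ω, ((2 * ε)⁻¹ * ((d : ℝ)⁻¹ * ∑ j, f (C d j ω)) ^ 2 + ε / 2) ∂P d := by
        refine integral_mono hS.abs ((hS2.const_mul _).add (integrable_const _)) fun ω => ?_
        dsimp only
        set s := (d : ℝ)⁻¹ * ∑ j, f (C d j ω)
        -- Young's inequality `|s| ≤ s² / (2ε) + ε / 2`, balanced for a second moment of size `ε ^
        -- 2`.
        have h1 : (2 * ε)⁻¹ * s ^ 2 + ε / 2 - |s| = (2 * ε)⁻¹ * (|s| - ε) ^ 2 := by
          rw [sub_sq, sq_abs]; field_simp; ring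
        have : 0 ≤ (2 * ε)⁻¹ * (|s| - ε) ^ 2 := by positivity
        linarith
    _ = (2 * ε)⁻¹ * ∫ ω, ((d : ℝ)⁻¹ * ∑ j, f (C d j ω)) ^ 2 ∂P d + ε / 2 := by
        rw [integral_add (hS2.const_mul _) (integrable_const _), integral_const_mul]
        simp
    _ ≤ (2 * ε)⁻¹ * ε ^ 2 + ε / 2 := by gcongr
    _ = ε := by field_simp; ring

/-- The truncation `min q M` of a nonnegative continuous function. -/
def trunc (q : E → ℝ) (hq : Continuous q) (hq0 : ∀ y, 0 ≤ q y) (M : ℕ) :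
    BoundedContinuousFunction E ℝ :=
  BoundedContinuousFunction.ofNormedAddCommGroup (fun y => min (q y) M) (by fun_prop) M
    (fun y => by
      rw [Real.norm_of_nonneg (le_min (hq0 y) (Nat.cast_nonneg M))]; exact min_le_right _ _)

lemma trunc_apply (q : E → ℝ) (hq : Continuous q) (hq0 : ∀ y, 0 ≤ q y) (M : ℕ) (y : E) :
    trunc q hq hq0 M y = min (q y) M := rfl

lemma exists_integral_sub_trunc_le {q : E → ℝ} (hq : Continuous q) (hq0 : ∀ y, 0 ≤ q y)
    (hρ : Integrable q ρ) {ε : ℝ} (hε : 0 < ε) :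
    ∃ M : ℕ, ∫ y, q y ∂ρ - ∫ y, trunc q hq hq0 M y ∂ρ < ε := by
  have ht : Tendsto (fun M : ℕ => ∫ y, trunc q hq hq0 M y ∂ρ) atTop (𝓝 (∫ y, q y ∂ρ)) := by
    refine tendsto_integral_of_dominated_convergence q
      (fun M => (trunc q hq hq0 M).continuous.aestronglyMeasurable) hρ
      (fun M => ae_of_all _ fun y => ?_) (ae_of_all _ fun y => ?_)
    · rw [trunc_apply, Real.norm_of_nonneg (le_min (hq0 y) (Nat.cast_nonneg M))]
      exact min_le_left _ _
    · refine tendsto_const_nhds.congr' ?_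
      filter_upwards [eventually_ge_atTop ⌈q y⌉₊] with M hM
      rw [trunc_apply, min_eq_left ((Nat.le_ceil _).trans (by exact_mod_cast hM))]
  obtain ⟨M, hM⟩ := (ht.eventually_const_lt (show ∫ y, q y ∂ρ - ε < ∫ y, q y ∂ρ by linarith)).exists
  exact ⟨M, by linarith⟩

/-- Uniform integrability: the truncation error of `q` is uniformly small over all channels. -/
theorem ConvergeIID.exists_eventually_integral_sub_trunc_le (h : ConvergeIID P C ρ)
    (hC : ∀ d j, AEMeasurable (C d j) (P d)) {q : E → ℝ} (hq : Continuous q)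
    (hq0 : ∀ y, 0 ≤ q y) (hqC : ∀ d j, Integrable (fun ω => q (C d j ω)) (P d))
    (hρ : Integrable q ρ) (hE : ∀ d j, ∫ ω, q (C d j ω) ∂P d = ∫ y, q y ∂ρ) {ε : ℝ} (hε : 0 < ε) :
    ∃ M : ℕ, (∫ y, q y ∂ρ - ∫ y, trunc q hq hq0 M y ∂ρ < ε) ∧ ∀ᶠ d in atTop, ∀ j : Fin d,
      ∫ ω, (q (C d j ω) - trunc q hq hq0 M (C d j ω)) ∂P d ≤ ε := by
  obtain ⟨M, hM⟩ := exists_integral_sub_trunc_le hq hq0 hρ (half_pos hε)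
  refine ⟨M, by linarith, ?_⟩
  filter_upwards [h.eventually_abs_integral_sub_lt_one (trunc q hq hq0 M) (half_pos hε)]
    with d hd j
  -- The full expectation of `q` is the same for each channel as under `ρ`, and the truncated one is
  -- bounded and converges, so the truncation error is asymptotically that of `ρ`. No moment beyond
  -- `q` is needed.
  rw [integral_sub (hqC d j) (integrable_boundedContinuous_comp hC _ d j), hE]
  have := abs_lt.1 (hd j)
  linarith [this.1]

/-- The weak law of large numbers for `q` of the channels, in `L¹`. -/
theorem ConvergeIID.tendsto_integral_abs_average_sub (h : ConvergeIID P C ρ)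
    (hC : ∀ d j, AEMeasurable (C d j) (P d)) {q : E → ℝ} (hq : Continuous q)
    (hq0 : ∀ y, 0 ≤ q y) (hqC : ∀ d j, Integrable (fun ω => q (C d j ω)) (P d))
    (hρ : Integrable q ρ) (hE : ∀ d j, ∫ ω, q (C d j ω) ∂P d = ∫ y, q y ∂ρ) :
    Tendsto (fun d : ℕ => ∫ ω, |(d : ℝ)⁻¹ * ∑ j, q (C d j ω) - ∫ y, q y ∂ρ| ∂P d)
      atTop (𝓝 0) := by
  rw [Metric.tendsto_nhds]
  intro ε' hε'
  -- Three errors of size at most `ε` follow: centered truncated average, truncation under the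
  -- channels, truncation under `ρ`.
  set ε := ε' / 4 with hεdef
  have hε : 0 < ε := by positivity
  obtain ⟨M, hM, hMd⟩ := h.exists_eventually_integral_sub_trunc_le hC hq hq0 hqC hρ hE hε
  set c := ∫ y, q y ∂ρ
  set f := trunc q hq hq0 M with hf
  set cM := ∫ y, f y ∂ρ with hcM
  have hfρ : Integrable f ρ := f.integrable ρ
  have hmean : ∫ y, (f - BoundedContinuousFunction.const E cM) y ∂ρ = 0 := by
    simp only [BoundedContinuousFunction.coe_sub, Pi.sub_apply,
      BoundedContinuousFunction.const_apply]
    rw [integral_sub hfρ (integrable_const _)]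
    simp [hcM]
  have hcc : cM ≤ c := integral_mono hfρ hρ fun y => min_le_left _ _
  filter_upwards [hMd, eventually_gt_atTop 0,
    h.eventually_integral_abs_average_le hC _ hmean hε] with d hd1 hd0 hd2
  have hd0' : (0 : ℝ) < d := by exact_mod_cast hd0
  rw [Real.dist_eq, sub_zero, abs_of_nonneg (integral_nonneg fun _ => abs_nonneg _)]
  have hfC : ∀ j, Integrable (fun ω => f (C d j ω)) (P d) :=
    integrable_boundedContinuous_comp hC f d
  have hi1 : Integrable (fun ω => (d : ℝ)⁻¹ * ∑ j, q (C d j ω) - c) (P d) :=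
    ((integrable_finsetSum _ fun j _ => hqC d j).const_mul _).sub (integrable_const _)
  have hi2 : Integrable (fun ω => (d : ℝ)⁻¹ * ∑ j, (f (C d j ω) - cM)) (P d) :=
    (integrable_finsetSum _ fun j _ => (hfC j).sub (integrable_const _)).const_mul _
  have hqf : ∀ j, Integrable (fun ω => q (C d j ω) - f (C d j ω)) (P d) := fun j =>
    (hqC d j).sub (hfC j)
  have hi3 : Integrable (fun ω => (d : ℝ)⁻¹ * ∑ j, (q (C d j ω) - f (C d j ω))) (P d) :=
    (integrable_finsetSum _ fun j _ => hqf j).const_mul _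
  have hi4 : Integrable (fun ω => |(d : ℝ)⁻¹ * ∑ j, (f (C d j ω) - cM)|
      + (d : ℝ)⁻¹ * ∑ j, (q (C d j ω) - f (C d j ω))) (P d) := hi2.abs.add hi3
  calc ∫ ω, |(d : ℝ)⁻¹ * ∑ j, q (C d j ω) - c| ∂P d
      ≤ ∫ ω, (|(d : ℝ)⁻¹ * ∑ j, (f (C d j ω) - cM)|
          + (d : ℝ)⁻¹ * ∑ j, (q (C d j ω) - f (C d j ω)) + (c - cM)) ∂P d := by
        refine integral_mono hi1.abs (hi4.add (integrable_const _)) fun ω => ?_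
        dsimp only
        have h0 : 0 ≤ (d : ℝ)⁻¹ * ∑ j, (q (C d j ω) - f (C d j ω)) :=
          mul_nonneg (by positivity) (Finset.sum_nonneg fun j _ =>
            sub_nonneg.2 (min_le_left _ _))
        have hsplit : (d : ℝ)⁻¹ * ∑ j, q (C d j ω) - c
            = (d : ℝ)⁻¹ * ∑ j, (f (C d j ω) - cM)
              + (d : ℝ)⁻¹ * ∑ j, (q (C d j ω) - f (C d j ω)) - (c - cM) := by
          simp only [Finset.sum_sub_distrib, Finset.sum_const, Finset.card_univ, Fintype.card_fin,
            nsmul_eq_mul]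
          field_simp
          ring
        rw [hsplit]
        refine (abs_sub _ _).trans ?_
        rw [abs_of_nonneg (sub_nonneg.2 hcc)]
        gcongr
        refine (abs_add_le _ _).trans ?_
        rw [abs_of_nonneg h0]
    _ = ∫ ω, |(d : ℝ)⁻¹ * ∑ j, (f (C d j ω) - cM)| ∂P d
          + (d : ℝ)⁻¹ * ∑ j, ∫ ω, (q (C d j ω) - f (C d j ω)) ∂P d + (c - cM) := by
        rw [integral_add hi4 (integrable_const _), integral_add hi2.abs hi3,
          integral_const_mul, integral_finsetSum _ fun j _ => hqf j]
        simp
    _ ≤ ε + (d : ℝ)⁻¹ * ∑ _j : Fin d, ε + ε := by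
        gcongr with j _
        · exact hd2
        · exact hd1 j
    _ = 3 * ε := by simp; field_simp; ring
    _ < ε' := by rw [hεdef]; linarith

end Converge

/-! ### Lindeberg replacement and the conditional central limit theorem. -/

lemma abs_exp_neg_sub_exp_neg_le {x y : ℝ} (hx : 0 ≤ x) (hy : 0 ≤ y) :
    |Real.exp (-x) - Real.exp (-y)| ≤ |x - y| := by
  wlog h : x ≤ y generalizing x y
  · rw [abs_sub_comm, abs_sub_comm x]; exact this hy hx (le_of_not_ge h)
  have h1 : Real.exp (-y) = Real.exp (-x) * Real.exp (-(y - x)) := by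
    rw [← Real.exp_add]; ring_nf
  have h2 : 1 - (y - x) ≤ Real.exp (-(y - x)) := by
    linarith [Real.add_one_le_exp (-(y - x))]
  have h3 : Real.exp (-x) ≤ 1 := Real.exp_le_one_iff.2 (by linarith)
  have h4 : Real.exp (-y) ≤ Real.exp (-x) := Real.exp_le_exp.2 (by linarith)
  rw [abs_of_nonneg (by linarith), abs_of_nonpos (by linarith), h1]
  nlinarith [Real.exp_pos (-x)]

/-- A bound for `charFun ν - exp(-σ²s²/2)` by a small multiple of `s²` for small `s`, and by a
fixed multiple of `s²` in general. -/
lemma exists_charFun_sub_exp_le {ν : Measure ℝ} [IsProbabilityMeasure ν] (hν : MemLp id 2 ν)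
    (h1 : ∫ x, x ∂ν = 0) {σ : ℝ} (h2 : variance id ν = σ ^ 2) {ε : ℝ} (hε : 0 < ε) :
    ∃ δ > 0, (∀ s : ℝ, |s| ≤ δ →
        ‖charFun ν s - Complex.exp (-(σ ^ 2 * s ^ 2 / 2) : ℝ)‖ ≤ ε * s ^ 2) ∧
      ∀ s : ℝ, δ < |s| →
        ‖charFun ν s - Complex.exp (-(σ ^ 2 * s ^ 2 / 2) : ℝ)‖ ≤ 2 / δ ^ 2 * s ^ 2 := by
  obtain ⟨δ, hδ, h⟩ := charFun_sub_exp_le hν h1 h2 hε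
  refine ⟨δ, hδ, h, fun s hs => ?_⟩
  have hb : ‖charFun ν s - Complex.exp (-(σ ^ 2 * s ^ 2 / 2) : ℝ)‖ ≤ 2 := by
    refine (norm_sub_le _ _).trans ?_
    have : ‖Complex.exp (-(σ ^ 2 * s ^ 2 / 2) : ℝ)‖ ≤ 1 := by
      rw [Complex.norm_exp_ofReal]
      exact Real.exp_le_one_iff.2 (by have : 0 ≤ σ ^ 2 * s ^ 2 / 2 := by positivity
                                      linarith)
    linarith [norm_charFun_le_one (μ := ν) (t := s)]
  refine hb.trans ?_
  have : δ ^ 2 ≤ s ^ 2 := by rw [← sq_abs s]; gcongr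
  rw [div_mul_eq_mul_div, le_div_iff₀ (by positivity)]
  linarith

section Converge

variable {E : Type*} [MeasurableSpace E] {Ω : ℕ → Type*} [∀ d, MeasurableSpace (Ω d)]
  {P : ∀ d, Measure (Ω d)} [∀ d, IsProbabilityMeasure (P d)] {C : ∀ d, Fin d → Ω d → E}
  {ρ : Measure E} [IsProbabilityMeasure ρ]
  [TopologicalSpace E] [SecondCountableTopology E] [BorelSpace E]

/-- The Lindeberg-type estimate: the summed error of replacing the characteristic function of `ν`
by that of the Gaussian law of the same variance is negligible. -/
theorem ConvergeIID.tendsto_integral_sum_charFun_sub (h : ConvergeIID P C ρ)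
    (hC : ∀ d j, AEMeasurable (C d j) (P d)) {g : E → ℝ} (hg : Continuous g)
    (hgC : ∀ d j, Integrable (fun ω => g (C d j ω) ^ 2) (P d))
    (hρ : Integrable (fun y => g y ^ 2) ρ)
    (hE : ∀ d j, ∫ ω, g (C d j ω) ^ 2 ∂P d = ∫ y, g y ^ 2 ∂ρ)
    {ν : Measure ℝ} [IsProbabilityMeasure ν] (hν : MemLp id 2 ν)
    (h1 : ∫ x, x ∂ν = 0) {σ : ℝ} (h2 : variance id ν = σ ^ 2) :
    Tendsto (fun d : ℕ => ∫ ω, ∑ j, ‖charFun ν (g (C d j ω) / √d)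
      - Complex.exp (-(σ ^ 2 * (g (C d j ω) / √d) ^ 2 / 2) : ℝ)‖ ∂P d) atTop (𝓝 0) := by
  rw [Metric.tendsto_nhds]
  intro ε' hε'
  set c := ∫ y, g y ^ 2 ∂ρ with hc
  have hc0 : 0 ≤ c := integral_nonneg fun _ => sq_nonneg _
  -- Makes the small-argument error `ε * c` at most `ε' / 2`; the `+ 1` covers `c = 0`. Likewise `η`
  -- below makes `4 / δ ^ 2 * η` equal to `ε' / 4`.
  set ε := ε' / (2 * (c + 1)) with hεdef
  have hε : 0 < ε := by positivity
  obtain ⟨δ, hδ, hsmall, hlarge⟩ := exists_charFun_sub_exp_le hν h1 h2 hε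
  set η := ε' * δ ^ 2 / 16 with hη
  have hη0 : 0 < η := by positivity
  have hq : Continuous fun y => g y ^ 2 := hg.pow 2
  have hq0 : ∀ y, 0 ≤ g y ^ 2 := fun y => sq_nonneg _
  obtain ⟨M, -, hM⟩ := h.exists_eventually_integral_sub_trunc_le hC hq hq0 hgC hρ hE hη0
  -- For widths beyond `N`, an argument `g y / √d` larger than `δ` forces `g y ^ 2 > 2 * M`. Then
  -- the truncation removes more than half of `g y ^ 2`, so the crude bound is absorbed by the
  -- truncation error.
  obtain ⟨N, hN⟩ := exists_nat_gt (2 * (M : ℝ) / δ ^ 2)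
  filter_upwards [hM, eventually_gt_atTop 0, eventually_ge_atTop N] with d hd hd0 hdN
  have hd0' : (0 : ℝ) < d := by exact_mod_cast hd0
  have hdM : 2 * (M : ℝ) < δ ^ 2 * d := by
    rw [div_lt_iff₀ (by positivity)] at hN
    have : (N : ℝ) ≤ d := by exact_mod_cast hdN
    nlinarith [pow_pos hδ 2]
  rw [Real.dist_eq, sub_zero, abs_of_nonneg (integral_nonneg fun _ =>
    Finset.sum_nonneg fun _ _ => norm_nonneg _)]
  set f := trunc (fun y => g y ^ 2) hq hq0 M with hf
  have hfC : ∀ j, Integrable (fun ω => f (C d j ω)) (P d) :=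
    integrable_boundedContinuous_comp hC f d
  have hpt : ∀ (j : Fin d) (ω : Ω d), ‖charFun ν (g (C d j ω) / √d)
      - Complex.exp (-(σ ^ 2 * (g (C d j ω) / √d) ^ 2 / 2) : ℝ)‖
      ≤ (d : ℝ)⁻¹ * (ε * g (C d j ω) ^ 2 + 4 / δ ^ 2 * (g (C d j ω) ^ 2 - f (C d j ω))) := by
    intro j ω
    set y := C d j ω
    have hs2 : (g y / √d) ^ 2 = (d : ℝ)⁻¹ * g y ^ 2 := by
      rw [div_pow, Real.sq_sqrt hd0'.le]; field_simp
    have hf0 : 0 ≤ g y ^ 2 - f y := sub_nonneg.2 (min_le_left _ _)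
    rcases le_or_gt |g y / √d| δ with hs | hs
    · refine (hsmall _ hs).trans ?_
      rw [hs2, mul_left_comm]
      gcongr
      have : 0 ≤ 4 / δ ^ 2 * (g y ^ 2 - f y) := by positivity
      linarith
    · refine (hlarge _ hs).trans ?_
      have hsq : δ ^ 2 < (g y / √d) ^ 2 := by rw [← sq_abs (g y / √d)]; gcongr
      have hgM : 2 * (M : ℝ) < g y ^ 2 := by
        rw [hs2, lt_inv_mul_iff₀ hd0'] at hsq
        linarith
      have hfM : f y ≤ M := min_le_right _ _
      rw [hs2, mul_left_comm]
      gcongr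
      have h5 : 2 / δ ^ 2 * g y ^ 2 ≤ 4 / δ ^ 2 * (g y ^ 2 - f y) := by
        rw [show (4 : ℝ) / δ ^ 2 = 2 / δ ^ 2 * 2 by ring, mul_assoc]
        gcongr
        linarith
      have : 0 ≤ ε * g y ^ 2 := by positivity
      linarith
  have hgf : ∀ j, Integrable (fun ω => g (C d j ω) ^ 2 - f (C d j ω)) (P d) := fun j =>
    (hgC d j).sub (hfC j)
  have hB : ∀ j, Integrable (fun ω => (d : ℝ)⁻¹ * (ε * g (C d j ω) ^ 2
      + 4 / δ ^ 2 * (g (C d j ω) ^ 2 - f (C d j ω)))) (P d) := fun j =>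
    (((hgC d j).const_mul _).add ((hgf j).const_mul _)).const_mul _
  calc ∫ ω, ∑ j, ‖charFun ν (g (C d j ω) / √d)
        - Complex.exp (-(σ ^ 2 * (g (C d j ω) / √d) ^ 2 / 2) : ℝ)‖ ∂P d
      ≤ ∫ ω, ∑ j, (d : ℝ)⁻¹ * (ε * g (C d j ω) ^ 2
          + 4 / δ ^ 2 * (g (C d j ω) ^ 2 - f (C d j ω))) ∂P d := by
        refine integral_mono_of_nonneg (ae_of_all _ fun ω => Finset.sum_nonneg fun _ _ =>
          norm_nonneg _) (integrable_finsetSum _ fun j _ => hB j)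
          (ae_of_all _ fun ω => Finset.sum_le_sum fun j _ => hpt j ω)
    _ = ∑ j : Fin d, (d : ℝ)⁻¹ * (ε * c
          + 4 / δ ^ 2 * ∫ ω, (g (C d j ω) ^ 2 - f (C d j ω)) ∂P d) := by
        rw [integral_finsetSum _ fun j _ => hB j]
        refine Finset.sum_congr rfl fun j _ => ?_
        rw [integral_const_mul, integral_add ((hgC d j).const_mul _)
          ((hgf j).const_mul _), integral_const_mul, integral_const_mul, hE]
    _ ≤ ∑ _j : Fin d, (d : ℝ)⁻¹ * (ε * c + 4 / δ ^ 2 * η) := by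
        gcongr with j _
        exact hd j
    _ = ε * c + 4 / δ ^ 2 * η := by simp; field_simp
    _ ≤ ε' / 2 + ε' / 4 := by
        gcongr
        · rw [hεdef, div_mul_eq_mul_div, div_le_div_iff₀ (by positivity) (by positivity)]
          nlinarith
        · rw [hη]; field_simp; norm_num
    _ < ε' := by linarith

/-- Conditionally on the channels, the characteristic function of `d^{-1/2} ∑ⱼ wⱼ g(Cⱼ)`, with
i.i.d. `wⱼ` of law `ν`, is asymptotically that of a Gaussian of nonrandom variance. -/
theorem ConvergeIID.tendsto_integral_norm_prod_charFun_sub (h : ConvergeIID P C ρ)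
    (hC : ∀ d j, AEMeasurable (C d j) (P d)) {g : E → ℝ} (hg : Continuous g)
    (hgC : ∀ d j, Integrable (fun ω => g (C d j ω) ^ 2) (P d))
    (hρ : Integrable (fun y => g y ^ 2) ρ)
    (hE : ∀ d j, ∫ ω, g (C d j ω) ^ 2 ∂P d = ∫ y, g y ^ 2 ∂ρ)
    {ν : Measure ℝ} [IsProbabilityMeasure ν] (hν : MemLp id 2 ν)
    (h1 : ∫ x, x ∂ν = 0) {σ : ℝ} (h2 : variance id ν = σ ^ 2) :
    Tendsto (fun d : ℕ => ∫ ω, ‖∏ j, charFun ν (g (C d j ω) / √d)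
      - Complex.exp (-(σ ^ 2 / 2 * ∫ y, g y ^ 2 ∂ρ) : ℝ)‖ ∂P d) atTop (𝓝 0) := by
  have ht1 := h.tendsto_integral_sum_charFun_sub hC hg hgC hρ hE hν h1 h2
  have ht2 := (h.tendsto_integral_abs_average_sub hC (q := fun y => g y ^ 2) (hg.pow 2)
    (fun y => sq_nonneg _) hgC hρ hE).const_mul (σ ^ 2 / 2)
  have ht := ht1.add ht2
  rw [mul_zero, add_zero] at ht
  refine squeeze_zero' (Eventually.of_forall fun d => integral_nonneg fun _ => norm_nonneg _)
    ?_ ht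
  filter_upwards [eventually_gt_atTop 0] with d hd0
  have hd0' : (0 : ℝ) < d := by exact_mod_cast hd0
  set c := ∫ y, g y ^ 2 ∂ρ with hc
  have hc0 : 0 ≤ c := integral_nonneg fun _ => sq_nonneg _
  have hmeas : ∀ j, AEMeasurable (fun ω => g (C d j ω)) (P d) := fun j =>
    hg.measurable.comp_aemeasurable (hC d j)
  have hi1 : Integrable (fun ω => ∑ j, ‖charFun ν (g (C d j ω) / √d)
      - Complex.exp (-(σ ^ 2 * (g (C d j ω) / √d) ^ 2 / 2) : ℝ)‖) (P d) := by
    refine integrable_finsetSum _ fun j _ => Integrable.of_bound (C := 2) ?_ ?_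
    · have hm : Measurable fun s : ℝ => ‖charFun ν (s / √d)
          - Complex.exp (-(σ ^ 2 * (s / √d) ^ 2 / 2) : ℝ)‖ := by
        have := measurable_charFun (μ := ν)
        fun_prop
      exact (hm.comp_aemeasurable (hmeas j)).aestronglyMeasurable
    · refine ae_of_all _ fun ω => ?_
      rw [norm_norm]
      refine (norm_sub_le _ _).trans ?_
      have : ‖Complex.exp (-(σ ^ 2 * (g (C d j ω) / √d) ^ 2 / 2) : ℝ)‖ ≤ 1 := by
        rw [Complex.norm_exp_ofReal]
        refine Real.exp_le_one_iff.2 ?_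
        have : 0 ≤ σ ^ 2 * (g (C d j ω) / √d) ^ 2 / 2 := by positivity
        linarith
      linarith [norm_charFun_le_one (μ := ν) (t := g (C d j ω) / √d)]
  have hi2 : Integrable (fun ω => σ ^ 2 / 2 * |(d : ℝ)⁻¹ * ∑ j, g (C d j ω) ^ 2 - c|) (P d) :=
    (((integrable_finsetSum _ fun j _ => hgC d j).const_mul _).sub
      (integrable_const _)).abs.const_mul _
  refine le_of_le_of_eq ?_ ((integral_add hi1 hi2).trans (by rw [integral_const_mul]))
  refine integral_mono_of_nonneg (ae_of_all _ fun _ => norm_nonneg _) (hi1.add hi2)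
    (ae_of_all _ fun ω => ?_)
  dsimp only
  -- The product of Gaussian factors depends on the channels only through the empirical average of
  -- `g ^ 2`, and `exp (-x)` is 1-Lipschitz for `x ≥ 0`, so the law of large numbers applies.
  have hprod : ∏ j, Complex.exp (-(σ ^ 2 * (g (C d j ω) / √d) ^ 2 / 2) : ℝ)
      = (Real.exp (-(σ ^ 2 / 2 * ((d : ℝ)⁻¹ * ∑ j, g (C d j ω) ^ 2))) : ℂ) := by
    rw [← Complex.exp_sum, ← Complex.ofReal_sum, Complex.ofReal_exp]
    congr 2
    rw [Finset.sum_neg_distrib, Finset.mul_sum, Finset.mul_sum]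
    congr 1
    refine Finset.sum_congr rfl fun j _ => ?_
    rw [div_pow, Real.sq_sqrt hd0'.le]; field_simp
  calc ‖∏ j, charFun ν (g (C d j ω) / √d) - Complex.exp (-(σ ^ 2 / 2 * c) : ℝ)‖
      ≤ ‖∏ j, charFun ν (g (C d j ω) / √d)
            - ∏ j, Complex.exp (-(σ ^ 2 * (g (C d j ω) / √d) ^ 2 / 2) : ℝ)‖
          + ‖∏ j, Complex.exp (-(σ ^ 2 * (g (C d j ω) / √d) ^ 2 / 2) : ℝ)
            - Complex.exp (-(σ ^ 2 / 2 * c) : ℝ)‖ := norm_sub_le_norm_sub_add_norm_sub _ _ _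
    _ ≤ _ := by
      gcongr
      · refine norm_prod_sub_prod_le_sum _ _ _ (fun _ _ => norm_charFun_le_one _) fun j _ => ?_
        rw [Complex.norm_exp_ofReal]
        refine Real.exp_le_one_iff.2 ?_
        have : 0 ≤ σ ^ 2 * (g (C d j ω) / √d) ^ 2 / 2 := by positivity
        linarith
      · rw [hprod, ← Complex.ofReal_exp, ← Complex.ofReal_sub, Complex.norm_real, Real.norm_eq_abs]
        refine (abs_exp_neg_sub_exp_neg_le ?_ ?_).trans ?_
        · have := Finset.sum_nonneg fun (j : Fin d) (_ : j ∈ Finset.univ) =>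
            sq_nonneg (g (C d j ω))
          positivity
        · positivity
        · rw [← mul_sub, abs_mul, abs_of_nonneg (show 0 ≤ σ ^ 2 / 2 by positivity)]

end Converge

/-! ### Lévy's continuity theorem for channels. -/

section CharFun

variable {E : Type*} [NormedAddCommGroup E] [InnerProductSpace ℝ E] [FiniteDimensional ℝ E]
  [SecondCountableTopology E] [MeasurableSpace E] [BorelSpace E]
  {Ω : ℕ → Type*} [∀ d, MeasurableSpace (Ω d)]
  {P : ∀ d, Measure (Ω d)} [∀ d, IsProbabilityMeasure (P d)] {C : ∀ d, Fin d → Ω d → E}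
  {ρ : Measure E} [IsProbabilityMeasure ρ]

/-- Lévy's continuity theorem for the convergence of channels. -/
theorem convergeIID_of_tendsto_charFun (hC : ∀ d j, AEMeasurable (C d j) (P d))
    (h : ∀ (m : ℕ) (e : ∀ d, Fin m ↪ Fin (m + d)) (t : Fin m → E),
      Tendsto (fun d => ∫ ω, Complex.exp
        ((∑ k, inner ℝ (C (m + d) (e d k) ω) (t k) : ℝ) * Complex.I) ∂P (m + d)) atTop
        (𝓝 (∏ k, charFun ρ (t k)))) :
    ConvergeIID P C ρ := by
  intro m e
  have hX : ∀ d, AEMeasurable (fun (ω : Ω (m + d)) (j : Fin m) => C (m + d) (e d j) ω)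
      (P (m + d)) := fun d => aemeasurable_pi_lambda _ fun j => hC _ _
  have hto : Continuous (WithLp.toLp 2 : (Fin m → E) → PiLp 2 fun _ : Fin m => E) :=
    PiLp.continuous_toLp 2 _
  have hof : Continuous (WithLp.ofLp : (PiLp 2 fun _ : Fin m => E) → (Fin m → E)) :=
    PiLp.continuous_ofLp 2 _
  -- Lévy's theorem needs an inner product space, so the tuple of channels is viewed in the `ℓ²`
  -- product and carried back along the continuous map `WithLp.ofLp`.
  have key : TendstoInDistribution
      (fun d (ω : Ω (m + d)) => WithLp.toLp 2 fun j : Fin m => C (m + d) (e d j) ω) atTop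
      (WithLp.toLp 2 : (Fin m → E) → PiLp 2 fun _ : Fin m => E) (fun d => P (m + d))
      (Measure.pi fun _ : Fin m => ρ) :=
    { forall_aemeasurable := fun d => hto.measurable.comp_aemeasurable (hX d)
      aemeasurable_limit := hto.measurable.aemeasurable
      tendsto := by
        refine ProbabilityMeasure.tendsto_iff_tendsto_charFun.2 fun t => ?_
        simp only [ProbabilityMeasure.coe_mk]
        rw [charFun_pi]
        refine (h m e fun k => t k).congr fun d => ?_
        have hXd : AEMeasurable (fun ω => WithLp.toLp 2 fun j : Fin m => C (m + d) (e d j) ω)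
          (P (m + d)) := hto.measurable.comp_aemeasurable (hX d)
        rw [charFun_apply, integral_map hXd (by fun_prop)]
        simp [PiLp.inner_apply] }
  exact key.continuous_comp hof

theorem ConvergeIID.tendsto_charFun (h : ConvergeIID P C ρ) {m : ℕ}
    (e : ∀ d, Fin m ↪ Fin (m + d)) (t : Fin m → E) :
    Tendsto (fun d => ∫ ω, Complex.exp
      ((∑ k, inner ℝ (C (m + d) (e d k) ω) (t k) : ℝ) * Complex.I) ∂P (m + d)) atTop
      (𝓝 (∏ k, charFun ρ (t k))) := by
  have ht := h m e
  have hcont : Continuous fun y : Fin m → E =>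
      Complex.exp ((∑ k, inner ℝ (y k) (t k) : ℝ) * Complex.I) := by fun_prop
  have h1 := (ProbabilityMeasure.tendsto_iff_forall_integral_rclike_tendsto ℂ).1 ht.tendsto
    (BoundedContinuousFunction.ofNormedAddCommGroup _ hcont 1 fun y => by
      rw [Complex.norm_exp_ofReal_mul_I])
  simp only [ProbabilityMeasure.coe_mk, Measure.map_id,
    BoundedContinuousFunction.coe_ofNormedAddCommGroup] at h1
  have h2 : ∫ y : Fin m → E, Complex.exp ((∑ k, inner ℝ (y k) (t k) : ℝ) * Complex.I)
      ∂(Measure.pi fun _ => ρ) = ∏ k, charFun ρ (t k) := by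
    simp_rw [charFun_apply]
    rw [← integral_fintype_prod_eq_prod (𝕜 := ℂ)]
    congr 1; ext y
    rw [← Complex.exp_sum]
    push_cast
    rw [Finset.sum_mul]
  rw [h2] at h1
  refine h1.congr fun d => ?_
  rw [integral_map (ht.forall_aemeasurable d) hcont.aestronglyMeasurable]

end CharFun

/-! ### Averaging over the weights of one layer. -/

section Weights

variable {Ω : Type*} [MeasurableSpace Ω] {P : Measure Ω}

/-- The joint characteristic function of independent linear combinations of rescaled weights. -/
lemma integral_exp_sum_weights {p m : ℕ} {ι : Type*} {ν : Measure ℝ}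
    {w : Fin p → ι → Ω → ℝ} (hlaw : ∀ j k, HasLaw (fun ω => √(p : ℝ) * w j k ω) ν P)
    (hind : iIndepFun (fun q : Fin p × ι => w q.1 q.2) P) (e : Fin m ↪ ι)
    (u : Fin m → Fin p → ℝ) :
    ∫ ω, Complex.exp ((∑ k, ∑ j, w j (e k) ω * u k j : ℝ) * Complex.I) ∂P
      = ∏ k, ∏ j, charFun ν (u k j / √p) := by
  -- An index in `Fin p` witnesses `p > 0`; for `p = 0` all sums and products over `j` are empty.
  have hp : Fin p → √(p : ℝ) ≠ 0 := fun j => by have := j.pos; positivity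
  have hw : ∀ j k, AEMeasurable (w j k) P := fun j k => by
    have := (hlaw j k).aemeasurable.const_mul (√(p : ℝ))⁻¹
    simpa [← mul_assoc, inv_mul_cancel₀ (hp j)] using this
  have h1 : iIndepFun (fun q : Fin m × Fin p => w q.2 (e q.1)) P :=
    hind.precomp (g := fun q : Fin m × Fin p => (q.2, e q.1)) (fun a b hab => by
      simp only [Prod.mk.injEq, EmbeddingLike.apply_eq_iff_eq] at hab
      exact Prod.ext hab.2 hab.1)
  have h2 := h1.integral_fun_prod_comp (𝕜 := ℂ)
    (f := fun q x => Complex.exp ((x * u q.1 q.2 : ℝ) * Complex.I)) (fun q => hw _ _)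
    (fun q => by fun_prop)
  rw [Fintype.prod_prod_type] at h2
  calc ∫ ω, Complex.exp ((∑ k, ∑ j, w j (e k) ω * u k j : ℝ) * Complex.I) ∂P
      = ∫ ω, ∏ q : Fin m × Fin p,
          Complex.exp ((w q.2 (e q.1) ω * u q.1 q.2 : ℝ) * Complex.I) ∂P := by
        congr 1; ext ω
        rw [← Complex.exp_sum, Fintype.sum_prod_type]
        congr 1
        push_cast
        simp_rw [Finset.sum_mul]
    _ = _ := by
        rw [h2]
        refine Finset.prod_congr rfl fun k _ => Finset.prod_congr rfl fun j _ => ?_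
        rw [charFun_apply_real, ← (hlaw j (e k)).map_eq,
          integral_map (hlaw j (e k)).aemeasurable (by fun_prop)]
        congr 1; ext ω
        congr 1
        push_cast
        have : ((√(p : ℝ) : ℝ) : ℂ) ≠ 0 := by exact_mod_cast hp j
        field_simp

end Weights

section Layer

variable {E : Type*} [NormedAddCommGroup E] [InnerProductSpace ℝ E] [FiniteDimensional ℝ E]
  [SecondCountableTopology E] [MeasurableSpace E] [BorelSpace E]

/-- Averaging over weights that are independent of the previous embedding. -/
lemma integral_exp_layer {Ω : Type*} [MeasurableSpace Ω] {P : Measure Ω} [IsProbabilityMeasure P]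
    {p m : ℕ} {ν : Measure ℝ} [IsProbabilityMeasure ν] {x : Fin p → Ω → E}
    (hx : ∀ j, AEMeasurable (x j) P)
    {w : Fin p → Fin p → Ω → ℝ} (hlaw : ∀ j k, HasLaw (fun ω => √(p : ℝ) * w j k ω) ν P)
    (hw : ∀ j k, AEMeasurable (w j k) P)
    (hind : iIndepFun (fun q : Fin p × Fin p => w q.1 q.2) P)
    (hxw : IndepFun (fun ω j => x j ω) (fun ω (q : Fin p × Fin p) => w q.1 q.2 ω) P)
    (A : E →L[ℝ] E) (e : Fin m ↪ Fin p) (s t : Fin m → E) :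
    ∫ ω, Complex.exp ((∑ k, (inner ℝ (x (e k) ω) (s k)
        + inner ℝ (∑ j, w j (e k) ω • A (x j ω)) (t k)) : ℝ) * Complex.I) ∂P
      = ∫ ω, Complex.exp ((∑ k, inner ℝ (x (e k) ω) (s k) : ℝ) * Complex.I) *
          ∏ k, ∏ j, charFun ν (inner ℝ (A (x j ω)) (t k) / √p) ∂P := by
  have hX : AEMeasurable (fun ω j => x j ω) P := aemeasurable_pi_lambda _ hx
  have hW : AEMeasurable (fun ω (q : Fin p × Fin p) => w q.1 q.2 ω) P :=
    aemeasurable_pi_lambda _ fun q => hw _ _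
  have : IsProbabilityMeasure (P.map fun ω j => x j ω) := Measure.isProbabilityMeasure_map hX
  have : IsProbabilityMeasure (P.map fun ω (q : Fin p × Fin p) => w q.1 q.2 ω) :=
    Measure.isProbabilityMeasure_map hW
  have hprod := (indepFun_iff_map_prod_eq_prod_map_map hX hW).1 hxw
  set F : (Fin p → E) × (Fin p × Fin p → ℝ) → ℂ := fun z =>
    Complex.exp ((∑ k, (inner ℝ (z.1 (e k)) (s k)
        + inner ℝ (∑ j, z.2 (j, e k) • A (z.1 j)) (t k)) : ℝ) * Complex.I) with hF
  have hFc : Continuous F := by fun_prop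
  have hFint : Integrable F ((P.map fun ω j => x j ω).prod
      (P.map fun ω (q : Fin p × Fin p) => w q.1 q.2 ω)) :=
    Integrable.of_bound hFc.aestronglyMeasurable 1 (ae_of_all _ fun z => by
      rw [hF, Complex.norm_exp_ofReal_mul_I])
  -- Fubini with the embedding frozen at `y`: the carried-over channels become a constant factor.
  have hinner : ∀ y : Fin p → E, ∫ z, F (y, z) ∂(P.map fun ω (q : Fin p × Fin p) => w q.1 q.2 ω)
      = Complex.exp ((∑ k, inner ℝ (y (e k)) (s k) : ℝ) * Complex.I) *
          ∏ k, ∏ j, charFun ν (inner ℝ (A (y j)) (t k) / √p) := by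
    intro y
    rw [integral_map hW (by fun_prop), ← integral_exp_sum_weights hlaw hind e,
      ← integral_const_mul]
    congr 1; ext ω
    simp only [hF]
    rw [← Complex.exp_add, ← add_mul, ← Complex.ofReal_add, ← Finset.sum_add_distrib]
    simp only [sum_inner, real_inner_smul_left]
  have hlast : AEStronglyMeasurable (fun y : Fin p → E =>
      Complex.exp ((∑ k, inner ℝ (y (e k)) (s k) : ℝ) * Complex.I) *
          ∏ k, ∏ j, charFun ν (inner ℝ (A (y j)) (t k) / √p)) (P.map fun ω j => x j ω) := by
    have := measurable_charFun (μ := ν)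
    have : Measurable (fun y : Fin p → E =>
      Complex.exp ((∑ k, inner ℝ (y (e k)) (s k) : ℝ) * Complex.I) *
          ∏ k, ∏ j, charFun ν (inner ℝ (A (y j)) (t k) / √p)) := by fun_prop
    exact this.aestronglyMeasurable
  calc _ = ∫ ω, F ((fun j => x j ω), fun q => w q.1 q.2 ω) ∂P := rfl
    _ = ∫ z, F z ∂(P.map fun ω => ((fun j => x j ω), fun q : Fin p × Fin p => w q.1 q.2 ω)) := by
        rw [integral_map (hX.prodMk hW) hFc.aestronglyMeasurable]
    _ = _ := by
        rw [hprod, integral_prod _ hFint]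
        simp_rw [hinner]
        rw [integral_map hX hlast]

variable {Ω : ℕ → Type*} [∀ d, MeasurableSpace (Ω d)]
  {P : ∀ d, Measure (Ω d)} [∀ d, IsProbabilityMeasure (P d)] {x : ∀ d, Fin d → Ω d → E}
  {ρ : Measure E} [IsProbabilityMeasure ρ]

/-- The channels of an embedding and of the linear image of the next random layer converge
jointly; the latter are Gaussian and independent of the former in the limit. -/
theorem ConvergeIID.tendsto_charFun_layer (h : ConvergeIID P x ρ)
    (hx : ∀ d j, AEMeasurable (x d j) (P d))
    (hx2 : ∀ d j a, Integrable (fun ω => (inner ℝ (x d j ω) a : ℝ) ^ 2) (P d))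
    (hρ2 : ∀ a, Integrable (fun y => (inner ℝ y a : ℝ) ^ 2) ρ)
    (hE : ∀ d j a, ∫ ω, (inner ℝ (x d j ω) a : ℝ) ^ 2 ∂P d = ∫ y, (inner ℝ y a : ℝ) ^ 2 ∂ρ)
    {ν : Measure ℝ} [IsProbabilityMeasure ν] (hν : MemLp id 2 ν)
    (h1 : ∫ x, x ∂ν = 0) {σ : ℝ} (h2 : variance id ν = σ ^ 2)
    {w : ∀ d, Fin d → Fin d → Ω d → ℝ}
    (hlaw : ∀ (d : ℕ) j k, HasLaw (fun ω => √(d : ℝ) * w d j k ω) ν (P d))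
    (hw : ∀ d j k, AEMeasurable (w d j k) (P d))
    (hind : ∀ d, iIndepFun (fun q : Fin d × Fin d => w d q.1 q.2) (P d))
    (hxw : ∀ d, IndepFun (fun ω j => x d j ω) (fun ω (q : Fin d × Fin d) => w d q.1 q.2 ω) (P d))
    (A : E →L[ℝ] E) {m : ℕ} (e : ∀ d, Fin m ↪ Fin (m + d)) (s t : Fin m → E) :
    Tendsto (fun d => ∫ ω, Complex.exp ((∑ k, (inner ℝ (x (m + d) (e d k) ω) (s k)
        + inner ℝ (∑ j, w (m + d) j (e d k) ω • A (x (m + d) j ω)) (t k)) : ℝ) * Complex.I)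
          ∂P (m + d)) atTop
      (𝓝 (∏ k, (charFun ρ (s k) *
        Complex.exp (-(σ ^ 2 / 2 * ∫ y, (inner ℝ (A y) (t k) : ℝ) ^ 2 ∂ρ) : ℝ)))) := by
  set c : Fin m → ℂ := fun k =>
    Complex.exp (-(σ ^ 2 / 2 * ∫ y, (inner ℝ (A y) (t k) : ℝ) ^ 2 ∂ρ) : ℝ) with hc
  have hadj : ∀ (y b : E), (inner ℝ (A y) b : ℝ) = inner ℝ y (A.adjoint b) := fun y b =>
    (ContinuousLinearMap.adjoint_inner_right A y b).symm
  have hkey : ∀ k, Tendsto (fun d : ℕ => ∫ ω, ‖∏ j, charFun ν (inner ℝ (A (x d j ω)) (t k) / √d)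
      - c k‖ ∂P d) atTop (𝓝 0) := fun k =>
    h.tendsto_integral_norm_prod_charFun_sub hx (g := fun y => inner ℝ (A y) (t k)) (by fun_prop)
      (fun d j => by simpa only [hadj] using hx2 d j _) (by simpa only [hadj] using hρ2 _)
      (fun d j => by simpa only [hadj] using hE d j _) hν h1 h2
  have hck : ∀ k, ‖c k‖ ≤ 1 := fun k => by
    rw [hc, Complex.norm_exp_ofReal]
    refine Real.exp_le_one_iff.2 ?_
    have : 0 ≤ ∫ y, (inner ℝ (A y) (t k) : ℝ) ^ 2 ∂ρ := integral_nonneg fun _ => sq_nonneg _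
    have : 0 ≤ σ ^ 2 / 2 * ∫ y, (inner ℝ (A y) (t k) : ℝ) ^ 2 ∂ρ := by positivity
    linarith
  have hlim1 := (h.tendsto_charFun e s).mul_const (∏ k, c k)
  rw [← Finset.prod_mul_distrib] at hlim1
  have hsum : Tendsto (fun d => ∑ k, ∫ ω, ‖∏ j, charFun ν
      (inner ℝ (A (x (m + d) j ω)) (t k) / √(m + d : ℕ)) - c k‖ ∂P (m + d)) atTop (𝓝 0) := by
    have := tendsto_finsetSum Finset.univ fun k (_ : k ∈ Finset.univ) => hkey k
    rw [Finset.sum_const_zero] at this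
    have hadd : Tendsto (fun d => m + d) atTop atTop :=
      tendsto_atTop_mono (fun d => Nat.le_add_left d m) tendsto_id
    exact this.comp hadd
  set T : ∀ d, Ω (m + d) → ℂ := fun d ω =>
    Complex.exp ((∑ k, inner ℝ (x (m + d) (e d k) ω) (s k) : ℝ) * Complex.I) with hT
  set Ψ : ∀ d, Fin m → Ω (m + d) → ℂ := fun d k ω =>
    ∏ j, charFun ν (inner ℝ (A (x (m + d) j ω)) (t k) / √(m + d : ℕ)) with hΨ
  have hTn : ∀ d ω, ‖T d ω‖ = 1 := fun d ω => by rw [hT, Complex.norm_exp_ofReal_mul_I]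
  have hΨn : ∀ d k ω, ‖Ψ d k ω‖ ≤ 1 := fun d k ω => by
    rw [hΨ, norm_prod]
    exact Finset.prod_le_one (fun _ _ => norm_nonneg _) fun _ _ => norm_charFun_le_one _
  have hTm : ∀ d, AEStronglyMeasurable (T d) (P (m + d)) := fun d => by
    have := fun j => hx (m + d) j
    refine AEMeasurable.aestronglyMeasurable ?_
    fun_prop
  have hΨm : ∀ d k, AEStronglyMeasurable (Ψ d k) (P (m + d)) := fun d k => by
    have := fun j => hx (m + d) j
    have hφ := measurable_charFun (μ := ν)
    refine (Finset.aemeasurable_fun_prod _ fun j _ => hφ.comp_aemeasurable ?_).aestronglyMeasurable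
    fun_prop
  have hTi : ∀ d, Integrable (T d) (P (m + d)) := fun d =>
    Integrable.of_bound (hTm d) 1 (ae_of_all _ fun ω => (hTn d ω).le)
  have hΨprod : ∀ d, AEStronglyMeasurable (fun ω => ∏ k, Ψ d k ω) (P (m + d)) := fun d =>
    Finset.aestronglyMeasurable_fun_prod _ fun k _ => hΨm d k
  have hΨi : ∀ d, Integrable (fun ω => ∏ k, Ψ d k ω) (P (m + d)) := fun d =>
    Integrable.of_bound (hΨprod d) 1 (ae_of_all _ fun ω => by
      rw [norm_prod]
      exact Finset.prod_le_one (fun _ _ => norm_nonneg _) fun _ _ => hΨn _ _ _)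
  have hTΨi : ∀ d, Integrable (fun ω => T d ω * ∏ k, Ψ d k ω) (P (m + d)) := fun d =>
    (hΨi d).bdd_mul (hTm d) (ae_of_all _ fun ω => (hTn d ω).le)
  have hdi : ∀ d k, Integrable (fun ω => ‖Ψ d k ω - c k‖) (P (m + d)) := fun d k =>
    ((Integrable.of_bound (hΨm d k) 1 (ae_of_all _ fun ω => hΨn d k ω)).sub
      (integrable_const _)).norm
  -- As `T` has modulus one, replacing the random factors `Ψ` by the constants `c` costs at most the
  -- sum of their `L¹` distances. The constants then leave the expectation, which is the asymptotic
  -- independence of old and new channels.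
  have herr : Tendsto (fun d => ∫ ω, T d ω * (∏ k, Ψ d k ω - ∏ k, c k) ∂P (m + d)) atTop
      (𝓝 0) := by
    refine squeeze_zero_norm (fun d => ?_) hsum
    rw [← integral_finsetSum _ fun k _ => hdi d k]
    refine norm_integral_le_of_norm_le (integrable_finsetSum _ fun k _ => hdi d k)
      (ae_of_all _ fun ω => ?_)
    rw [norm_mul, hTn, one_mul]
    exact norm_prod_sub_prod_le_sum _ _ _ (fun k _ => hΨn d k ω) fun k _ => hck k
  have hfin := hlim1.add herr
  rw [add_zero] at hfin
  refine hfin.congr fun d => ?_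
  rw [integral_exp_layer (hx _) (hlaw _) (hw _) (hind _) (hxw _) A (e d) s t,
    ← integral_mul_const, ← integral_add ((hTi d).mul_const _)]
  · congr 1; ext ω; ring
  · simp_rw [mul_sub]
    exact (hTΨi d).sub ((hTi d).mul_const _)

end Layer

/-! ### Exact second moments at finite width. -/

section Moments

variable {Ω : Type*} [MeasurableSpace Ω] {P : Measure Ω} [IsProbabilityMeasure P]

lemma integral_sq_eq_of_mean_zero {κ : Measure ℝ} [IsProbabilityMeasure κ] (hκ : MemLp id 2 κ)
    (h1 : ∫ x, x ∂κ = 0) {σ : ℝ} (h2 : variance id κ = σ ^ 2) : ∫ x, x ^ 2 ∂κ = σ ^ 2 := by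
  rw [variance_eq_sub hκ] at h2
  simpa [h1] using h2

/-- Moments of `∑ⱼ wⱼ uⱼ + v`, where the `wⱼ` are centered, uncorrelated, of variance `τ`, and
independent of `(u, v)`. -/
lemma memLp_and_integral_sq_sum_mul_add {p : ℕ} {u w : Fin p → Ω → ℝ} {v : Ω → ℝ} {τ : ℝ}
    (hu : ∀ j, MemLp (u j) 2 P) (hv : MemLp v 2 P) (hw : ∀ j, MemLp (w j) 2 P)
    (hmean : ∀ j, ∫ ω, w j ω ∂P = 0)
    (hcov : ∀ i j, ∫ ω, w i ω * w j ω ∂P = if i = j then τ else 0)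
    (hind : IndepFun (fun ω => ((fun j => u j ω), v ω)) (fun ω j => w j ω) P) :
    MemLp (fun ω => ∑ j, w j ω * u j ω + v ω) 2 P ∧
      ∫ ω, (∑ j, w j ω * u j ω + v ω) ^ 2 ∂P = τ * ∑ j, ∫ ω, u j ω ^ 2 ∂P + ∫ ω, v ω ^ 2 ∂P := by
  have huu : ∀ i j, Integrable (fun ω => u i ω * u j ω) P := fun i j => (hu i).integrable_mul (hu j)
  have hww : ∀ i j, Integrable (fun ω => w i ω * w j ω) P := fun i j => (hw i).integrable_mul (hw j)
  have huv : ∀ j, Integrable (fun ω => u j ω * v ω) P := fun j => (hu j).integrable_mul hv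
  have hI2 : ∀ i j, IndepFun (fun ω => w i ω * w j ω) (fun ω => u i ω * u j ω) P := fun i j =>
    (hind.comp (φ := fun z : (Fin p → ℝ) × ℝ => z.1 i * z.1 j)
      (ψ := fun z : Fin p → ℝ => z i * z j) (by fun_prop) (by fun_prop)).symm
  have hI1 : ∀ j, IndepFun (w j) (fun ω => u j ω * v ω) P := fun j =>
    (hind.comp (φ := fun z : (Fin p → ℝ) × ℝ => z.1 j * z.2)
      (ψ := fun z : Fin p → ℝ => z j) (by fun_prop) (by fun_prop)).symm
  have hi2 : ∀ i j, Integrable (fun ω => (w i ω * w j ω) * (u i ω * u j ω)) P := fun i j =>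
    (hI2 i j).integrable_mul (hww i j) (huu i j)
  have hi1 : ∀ j, Integrable (fun ω => w j ω * (u j ω * v ω)) P := fun j =>
    (hI1 j).integrable_mul ((hw j).integrable (by norm_num)) (huv j)
  -- Square integrability of the product comes from independence of `w j ^ 2` and `u j ^ 2`; Hölder
  -- would give only `L¹`.
  have hmem : ∀ j, MemLp (fun ω => w j ω * u j ω) 2 P := fun j => by
    refine (memLp_two_iff_integrable_sq (f := fun ω => w j ω * u j ω)
      ((hw j).aestronglyMeasurable.mul (hu j).aestronglyMeasurable)).2
      ((hi2 j j).congr (ae_of_all _ fun ω => ?_))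
    ring
  refine ⟨(memLp_finsetSum _ fun j _ => hmem j).add hv, ?_⟩
  have hexp : ∀ ω, (∑ j, w j ω * u j ω + v ω) ^ 2
      = ∑ i, ∑ j, (w i ω * w j ω) * (u i ω * u j ω) + 2 * ∑ j, w j ω * (u j ω * v ω)
        + v ω ^ 2 := by
    intro ω
    rw [add_sq, sq (∑ j, _), Finset.sum_mul_sum, mul_assoc, Finset.sum_mul]
    congr 2
    · exact Finset.sum_congr rfl fun i _ => Finset.sum_congr rfl fun j _ => by ring
    · congr 1
      exact Finset.sum_congr rfl fun j _ => by ring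
  have hA : Integrable (fun ω => ∑ i, ∑ j, (w i ω * w j ω) * (u i ω * u j ω)) P :=
    integrable_finsetSum _ fun i _ => integrable_finsetSum _ fun j _ => hi2 i j
  have hB : Integrable (fun ω => 2 * ∑ j, w j ω * (u j ω * v ω)) P :=
    (integrable_finsetSum _ fun j _ => hi1 j).const_mul _
  have hAB : Integrable (fun ω => ∑ i, ∑ j, (w i ω * w j ω) * (u i ω * u j ω)
      + 2 * ∑ j, w j ω * (u j ω * v ω)) P := hA.add hB
  simp_rw [hexp]
  rw [integral_add hAB hv.integrable_sq, integral_add hA hB, integral_const_mul,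
    integral_finsetSum _ fun j _ => hi1 j,
    integral_finsetSum _ fun i _ => integrable_finsetSum _ fun j _ => hi2 i j]
  have h1 : ∀ j, ∫ ω, w j ω * (u j ω * v ω) ∂P = 0 := fun j => by
    have := (hI1 j).integral_fun_mul_eq_mul_integral (hw j).aestronglyMeasurable
      (huv j).aestronglyMeasurable
    rw [this, hmean, zero_mul]
  have h2 : ∀ i, ∫ ω, ∑ j, (w i ω * w j ω) * (u i ω * u j ω) ∂P = τ * ∫ ω, u i ω ^ 2 ∂P := by
    intro i
    rw [integral_finsetSum _ fun j _ => hi2 i j]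
    have : ∀ j, ∫ ω, (w i ω * w j ω) * (u i ω * u j ω) ∂P
        = if i = j then τ * ∫ ω, u i ω ^ 2 ∂P else 0 := fun j => by
      rw [(hI2 i j).integral_fun_mul_eq_mul_integral (hww i j).aestronglyMeasurable
        (huu i j).aestronglyMeasurable, hcov]
      split_ifs with hij
      · subst hij; simp [sq]
      · rw [zero_mul]
    simp [this]
  simp [h1, h2, Finset.mul_sum]

omit [IsProbabilityMeasure P] in
/-- First and second moments of independent rescaled weights. -/
lemma weight_moments {p : ℕ} {ι : Type*} {ν : Measure ℝ} [IsProbabilityMeasure ν]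
    (hν : MemLp id 2 ν) (h1 : ∫ x, x ∂ν = 0) {σ : ℝ} (h2 : variance id ν = σ ^ 2)
    {w : Fin p → ι → Ω → ℝ} (hlaw : ∀ j k, HasLaw (fun ω => √(p : ℝ) * w j k ω) ν P)
    (hind : iIndepFun (fun q : Fin p × ι => w q.1 q.2) P) (k : ι) :
    (∀ j, MemLp (w j k) 2 P) ∧ (∀ j, ∫ ω, w j k ω ∂P = 0) ∧
      ∀ i j, ∫ ω, w i k ω * w j k ω ∂P = if i = j then σ ^ 2 / p else 0 := by
  have hp : Fin p → √(p : ℝ) ≠ 0 := fun j => by have := j.pos; positivity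
  have hwe : ∀ j, w j k = fun ω => (√(p : ℝ))⁻¹ * (√(p : ℝ) * w j k ω) := fun j => by
    ext ω; rw [← mul_assoc, inv_mul_cancel₀ (hp j), one_mul]
  have hmem' : ∀ j, MemLp (fun ω => √(p : ℝ) * w j k ω) 2 P := fun j => by
    have h := hν
    rw [← (hlaw j k).map_eq] at h
    exact (memLp_map_measure_iff aestronglyMeasurable_id (hlaw j k).aemeasurable).1 h
  have hmem : ∀ j, MemLp (w j k) 2 P := fun j => by
    rw [hwe j]; exact (hmem' j).const_mul _
  have hmean : ∀ j, ∫ ω, w j k ω ∂P = 0 := fun j => by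
    rw [hwe j, integral_const_mul, (hlaw j k).integral_eq, h1, mul_zero]
  refine ⟨hmem, hmean, fun i j => ?_⟩
  split_ifs with hij
  · subst hij
    have h3 : ∫ ω, (√(p : ℝ) * w i k ω) ^ 2 ∂P = σ ^ 2 := by
      rw [← integral_sq_eq_of_mean_zero hν h1 h2]
      exact (hlaw i k).integral_comp (f := fun x : ℝ => x ^ 2) (by fun_prop)
    simp_rw [mul_pow, integral_const_mul, Real.sq_sqrt (Nat.cast_nonneg p)] at h3
    have hp0 : (p : ℝ) ≠ 0 := by have := i.pos; positivity
    rw [eq_div_iff hp0, ← h3]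
    simp_rw [← sq]; ring
  · have h4 : IndepFun (w i k) (w j k) P :=
      hind.indepFun (i := (i, k)) (j := (j, k)) (by simpa using hij)
    rw [h4.integral_fun_mul_eq_mul_integral (hmem i).aestronglyMeasurable
      (hmem j).aestronglyMeasurable, hmean, zero_mul]

variable {E : Type*} [NormedAddCommGroup E] [InnerProductSpace ℝ E] [FiniteDimensional ℝ E]
  [MeasurableSpace E] [BorelSpace E]

/-- The recursion for the second moments of the channels. -/
lemma layer_moments {p : ℕ} {ν : Measure ℝ} [IsProbabilityMeasure ν]
    (hν : MemLp id 2 ν) (h1 : ∫ x, x ∂ν = 0) {σ : ℝ} (h2 : variance id ν = σ ^ 2)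
    {x : Fin p → Ω → E} (hx2 : ∀ j a, MemLp (fun ω => (inner ℝ (x j ω) a : ℝ)) 2 P)
    {Q : E → ℝ} (hQ : ∀ j a, ∫ ω, (inner ℝ (x j ω) a : ℝ) ^ 2 ∂P = Q a)
    {w : Fin p → Fin p → Ω → ℝ} (hlaw : ∀ j k, HasLaw (fun ω => √(p : ℝ) * w j k ω) ν P)
    (hind : iIndepFun (fun q : Fin p × Fin p => w q.1 q.2) P)
    (hxw : IndepFun (fun ω j => x j ω) (fun ω (q : Fin p × Fin p) => w q.1 q.2 ω) P)
    (A : E →L[ℝ] E) (α β : ℝ) (k : Fin p) (a : E) :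
    MemLp (fun ω => (inner ℝ (α • ∑ j, w j k ω • A (x j ω) + β • x k ω) a : ℝ)) 2 P ∧
      ∫ ω, (inner ℝ (α • ∑ j, w j k ω • A (x j ω) + β • x k ω) a : ℝ) ^ 2 ∂P
        = α ^ 2 * σ ^ 2 * Q (A.adjoint a) + β ^ 2 * Q a := by
  obtain ⟨hwm, hw0, hwc⟩ := weight_moments hν h1 h2 hlaw hind k
  have hadj : ∀ (y b : E), (inner ℝ (A y) b : ℝ) = inner ℝ y (A.adjoint b) := fun y b =>
    (ContinuousLinearMap.adjoint_inner_right A y b).symm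
  have hI : IndepFun (fun ω => ((fun j => α * inner ℝ (x j ω) (A.adjoint a)),
      β * inner ℝ (x k ω) a)) (fun ω j => w j k ω) P :=
    hxw.comp (φ := fun y : Fin p → E => ((fun j => α * inner ℝ (y j) (A.adjoint a)),
      β * inner ℝ (y k) a)) (ψ := fun (z : Fin p × Fin p → ℝ) j => z (j, k))
      (by fun_prop) (by fun_prop)
  have hmain := memLp_and_integral_sq_sum_mul_add (fun j => (hx2 j (A.adjoint a)).const_mul α)
    ((hx2 k a).const_mul β) hwm hw0 hwc hI
  have heq : ∀ ω, (inner ℝ (α • ∑ j, w j k ω • A (x j ω) + β • x k ω) a : ℝ)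
      = ∑ j, w j k ω * (α * inner ℝ (x j ω) (A.adjoint a)) + β * inner ℝ (x k ω) a := by
    intro ω
    rw [inner_add_left, real_inner_smul_left, real_inner_smul_left, sum_inner, Finset.mul_sum]
    congr 1
    exact Finset.sum_congr rfl fun j _ => by rw [real_inner_smul_left, hadj]; ring
  simp_rw [heq]
  refine ⟨hmain.1, hmain.2.trans ?_⟩
  -- The weight variance `σ ^ 2 / p` meets `p` equal summands, as every channel has the same form
  -- `Q`; the width cancels.
  have hp0 : (p : ℝ) ≠ 0 := by have := k.pos; positivity
  simp_rw [mul_pow, integral_const_mul, hQ]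
  simp
  field_simp

end Moments

/-! ### Covariance matrices and the channel recursion. -/

section Matrices

variable {V : Type*} [Fintype V] [DecidableEq V] {d₀ d : ℕ}

/-- A square matrix as a continuous linear map of `ℝⁿ`. -/
def matCLM (M : Matrix V V ℝ) : EuclideanSpace ℝ V →L[ℝ] EuclideanSpace ℝ V :=
  Matrix.toEuclideanCLM (𝕜 := ℝ) M

lemma matCLM_apply (M : Matrix V V ℝ) (y : EuclideanSpace ℝ V) (i : V) :
    matCLM M y i = M.mulVec y.ofLp i := by
  simp [matCLM, Matrix.ofLp_toEuclideanCLM]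

lemma adjoint_matCLM {M : Matrix V V ℝ} (hM : M.IsHermitian) :
    (matCLM M).adjoint = matCLM M := by
  rw [← ContinuousLinearMap.star_eq_adjoint, matCLM, ← map_star, Matrix.star_eq_conjTranspose, hM]

lemma isHermitian_normAdj (G : SimpleGraph V) [DecidableRel G.Adj] :
    (normAdj G).IsHermitian := by
  have h : (G.adjMatrix ℝ + 1).transpose = G.adjMatrix ℝ + 1 := by simp
  rw [Matrix.IsHermitian, Matrix.conjTranspose_eq_transpose_of_trivial, normAdj,
    Matrix.transpose_mul, Matrix.transpose_mul, Matrix.diagonal_transpose, h, Matrix.mul_assoc]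

/-- The quadratic form of a matrix on `ℝⁿ`. -/
def quadForm (M : Matrix V V ℝ) (a : EuclideanSpace ℝ V) : ℝ := a.ofLp ⬝ᵥ M.mulVec a.ofLp

lemma quadForm_smul (c : ℝ) (M : Matrix V V ℝ) (a : EuclideanSpace ℝ V) :
    quadForm (c • M) a = c * quadForm M a := by
  simp [quadForm, Matrix.smul_mulVec]

lemma quadForm_add (M N : Matrix V V ℝ) (a : EuclideanSpace ℝ V) :
    quadForm (M + N) a = quadForm M a + quadForm N a := by
  simp [quadForm, Matrix.add_mulVec]

lemma quadForm_conj {B : Matrix V V ℝ} (hB : B.IsHermitian) (M : Matrix V V ℝ)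
    (a : EuclideanSpace ℝ V) : quadForm (B * M * B) a = quadForm M (matCLM B a) := by
  have hBt : B.transpose = B := by
    rwa [Matrix.IsHermitian, Matrix.conjTranspose_eq_transpose_of_trivial] at hB
  have h : (matCLM B a).ofLp = B.mulVec a.ofLp := funext fun i => matCLM_apply B a i
  rw [quadForm, quadForm, h, ← Matrix.mulVec_mulVec, ← Matrix.mulVec_mulVec,
    Matrix.dotProduct_mulVec, ← Matrix.mulVec_transpose, hBt]

lemma posSemidef_postCov {Ahat : Matrix V V ℝ} (hA : Ahat.IsHermitian) (X : Matrix V (Fin d₀) ℝ)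
    (α β σw : ℝ) (l : ℕ) : (postCov Ahat X α β σw l).PosSemidef := by
  induction l with
  | zero =>
    rw [postCov, ← Matrix.conjTranspose_eq_transpose_of_trivial]
    exact (Matrix.posSemidef_self_mul_conjTranspose X).smul (by positivity)
  | succ l ih =>
    rw [postCov]
    have h1 := ih.mul_mul_conjTranspose_same Ahat
    rw [hA] at h1
    exact (h1.smul (by positivity)).add (ih.smul (by positivity))

/-- The linear map `M ↦ σw² Â M Â` commutes with the common recursion step `M ↦ α²σw² Â M Â + β² M`,
so it is enough to match the initial values. This links the stated recursion to the variance
produced by the conditional central limit theorem. -/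
lemma preCov_succ (Ahat : Matrix V V ℝ) (X : Matrix V (Fin d₀) ℝ) (α β σw : ℝ) (l : ℕ) :
    preCov Ahat X α β σw (l + 1) = σw ^ 2 • (Ahat * postCov Ahat X α β σw l * Ahat) := by
  induction l with
  | zero =>
    rw [preCov, postCov, Matrix.mul_smul, Matrix.smul_mul, smul_smul, Matrix.mul_assoc Ahat X]
    congr 1; ring
  | succ l ih =>
    rw [preCov, ih, postCov]
    simp only [Matrix.mul_add, Matrix.add_mul, Matrix.mul_smul, Matrix.smul_mul, smul_add,
      smul_smul]
    ring_nf

lemma posSemidef_preCov_succ {Ahat : Matrix V V ℝ} (hA : Ahat.IsHermitian)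
    (X : Matrix V (Fin d₀) ℝ) (α β σw : ℝ) (l : ℕ) :
    (preCov Ahat X α β σw (l + 1)).PosSemidef := by
  rw [preCov_succ]
  have h1 := (posSemidef_postCov hA X α β σw l).mul_mul_conjTranspose_same Ahat
  rw [hA] at h1
  exact h1.smul (by positivity)

lemma quadForm_preCov_succ {Ahat : Matrix V V ℝ} (hA : Ahat.IsHermitian)
    (X : Matrix V (Fin d₀) ℝ) (α β σw : ℝ) (l : ℕ) (a : EuclideanSpace ℝ V) :
    quadForm (preCov Ahat X α β σw (l + 1)) a
      = σw ^ 2 * quadForm (postCov Ahat X α β σw l) (matCLM Ahat a) := by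
  rw [preCov_succ, quadForm_smul, quadForm_conj hA]

lemma quadForm_postCov_succ {Ahat : Matrix V V ℝ} (hA : Ahat.IsHermitian)
    (X : Matrix V (Fin d₀) ℝ) (α β σw : ℝ) (l : ℕ) (a : EuclideanSpace ℝ V) :
    quadForm (postCov Ahat X α β σw (l + 1)) a
      = α ^ 2 * σw ^ 2 * quadForm (postCov Ahat X α β σw l) (matCLM Ahat a)
        + β ^ 2 * quadForm (postCov Ahat X α β σw l) a := by
  rw [postCov, quadForm_add, quadForm_smul, quadForm_smul, quadForm_conj hA]

/-- The `i`-th feature, as a vector of `ℝⁿ`. -/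
def feature (X : Matrix V (Fin d₀) ℝ) (i : Fin d₀) : EuclideanSpace ℝ V :=
  WithLp.toLp 2 fun v => X v i

lemma quadForm_postCov_zero (Ahat : Matrix V V ℝ) (X : Matrix V (Fin d₀) ℝ) (α β σw : ℝ)
    (a : EuclideanSpace ℝ V) :
    quadForm (postCov Ahat X α β σw 0) a
      = σw ^ 2 / d₀ * ∑ i, (inner ℝ (feature X i) a : ℝ) ^ 2 := by
  rw [postCov, quadForm_smul, quadForm, ← Matrix.mulVec_mulVec, Matrix.dotProduct_mulVec,
    ← Matrix.mulVec_transpose]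
  congr 1
  refine Finset.sum_congr rfl fun i _ => ?_
  rw [sq]
  congr 1 <;>
    simp [feature, PiLp.inner_apply, Matrix.mulVec, dotProduct, mul_comm]

lemma channel_preAct_succ (Ahat : Matrix V V ℝ) (X : Matrix V (Fin d₀) ℝ) (α β : ℝ)
    (W0 : Matrix (Fin d₀) (Fin d) ℝ) (W : ℕ → Matrix (Fin d) (Fin d) ℝ) (l : ℕ) (k : Fin d) :
    channel (preAct Ahat X α β id W0 W 0 (l + 1)) k
      = ∑ j, W (l + 1) j k • matCLM Ahat (channel (postAct Ahat X α β id W0 W 0 l) j) := by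
  ext v
  simp [channel, preAct, conv, Matrix.mul_apply, matCLM_apply, Matrix.mulVec, dotProduct,
    Matrix.vecMulVec, mul_comm]

lemma channel_postAct_succ (Ahat : Matrix V V ℝ) (X : Matrix V (Fin d₀) ℝ) (α β : ℝ)
    (W0 : Matrix (Fin d₀) (Fin d) ℝ) (W : ℕ → Matrix (Fin d) (Fin d) ℝ) (l : ℕ) (k : Fin d) :
    channel (postAct Ahat X α β id W0 W 0 (l + 1)) k
      = α • ∑ j, W (l + 1) j k • matCLM Ahat (channel (postAct Ahat X α β id W0 W 0 l) j)
        + β • channel (postAct Ahat X α β id W0 W 0 l) k := by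
  rw [← channel_preAct_succ]
  ext v
  simp [channel, postAct, preAct]

lemma channel_postAct_zero (Ahat : Matrix V V ℝ) (X : Matrix V (Fin d₀) ℝ) (α β : ℝ)
    (W0 : Matrix (Fin d₀) (Fin d) ℝ) (W : ℕ → Matrix (Fin d) (Fin d) ℝ) (k : Fin d) :
    channel (postAct Ahat X α β id W0 W 0 0) k = ∑ i, W0 i k • feature X i := by
  ext v
  simp [channel, postAct, feature, Matrix.mul_apply, mul_comm]

end Matrices

/-! ### Measurability and independence across layers. -/

section RandomInit

variable {V : Type*} [Fintype V] [DecidableEq V] {Ω : Type*} [MeasurableSpace Ω] {P : Measure Ω}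
  {d₀ d L : ℕ} {ν : ℕ → Measure ℝ} {W0 : Ω → Matrix (Fin d₀) (Fin d) ℝ}
  {W : ℕ → Ω → Matrix (Fin d) (Fin d) ℝ}

/-- The family of all weights, as in `IsRandomInit.indep`. -/
def weights (L : ℕ) (W0 : Ω → Matrix (Fin d₀) (Fin d) ℝ)
    (W : ℕ → Ω → Matrix (Fin d) (Fin d) ℝ) : (Fin d₀ × Fin d) ⊕ (Fin L × Fin d × Fin d) → Ω → ℝ :=
  Sum.elim (fun (p : Fin d₀ × Fin d) (ω : Ω) => W0 ω p.1 p.2)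
    (fun (q : Fin L × Fin d × Fin d) (ω : Ω) => W (q.1 + 1) ω q.2.1 q.2.2)

lemma aemeasurable_of_sqrt_mul {p : ℕ} (hp : 0 < p) {κ : Measure ℝ} {f : Ω → ℝ}
    (h : HasLaw (fun ω => √(p : ℝ) * f ω) κ P) : AEMeasurable f P := by
  have hp' : √(p : ℝ) ≠ 0 := by positivity
  simpa [← mul_assoc, inv_mul_cancel₀ hp'] using h.aemeasurable.const_mul (√(p : ℝ))⁻¹

lemma IsRandomInit.aemeasurable_zero (h : IsRandomInit P L ν W0 W) (i : Fin d₀) (k : Fin d) :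
    AEMeasurable (fun ω => W0 ω i k) P :=
  aemeasurable_of_sqrt_mul i.pos (h.law_zero i k)

lemma IsRandomInit.aemeasurable_hidden (h : IsRandomInit P L ν W0 W) {l : ℕ} (hl : l < L)
    (j k : Fin d) : AEMeasurable (fun ω => W (l + 1) ω j k) P :=
  aemeasurable_of_sqrt_mul j.pos (h.law_hidden (l + 1) (by omega) hl j k)

lemma IsRandomInit.aemeasurable_weights (h : IsRandomInit P L ν W0 W)
    (i : (Fin d₀ × Fin d) ⊕ (Fin L × Fin d × Fin d)) : AEMeasurable (weights L W0 W i) P := by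
  rcases i with q | q
  · exact h.aemeasurable_zero q.1 q.2
  · exact h.aemeasurable_hidden q.1.2 q.2.1 q.2.2

lemma IsRandomInit.iIndepFun_zero (h : IsRandomInit P L ν W0 W) :
    iIndepFun (fun (q : Fin d₀ × Fin d) ω => W0 ω q.1 q.2) P :=
  h.indep.precomp (g := Sum.inl) Sum.inl_injective

lemma IsRandomInit.iIndepFun_hidden (h : IsRandomInit P L ν W0 W) {l : ℕ} (hl : l < L) :
    iIndepFun (fun (q : Fin d × Fin d) ω => W (l + 1) ω q.1 q.2) P :=
  h.indep.precomp (g := fun q : Fin d × Fin d =>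
    (Sum.inr ((⟨l, hl⟩ : Fin L), q) : (Fin d₀ × Fin d) ⊕ (Fin L × Fin d × Fin d)))
    fun a b hab => by simpa using hab

/-- The layer that a weight belongs to. -/
def layerOf : (Fin d₀ × Fin d) ⊕ (Fin L × Fin d × Fin d) → ℕ :=
  Sum.elim (fun _ => 0) (fun q => q.1 + 1)

/-- The weights of the layers up to `l`. -/
def layersUpTo (d₀ d L l : ℕ) : Finset ((Fin d₀ × Fin d) ⊕ (Fin L × Fin d × Fin d)) :=
  Finset.univ.filter fun i => layerOf i ≤ l

/-- The weights of the layer `l`. -/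
def layerEq (d₀ d L l : ℕ) : Finset ((Fin d₀ × Fin d) ⊕ (Fin L × Fin d × Fin d)) :=
  Finset.univ.filter fun i => layerOf i = l

/-- The embedding after layer `l` is a measurable function of the weights of the layers up to
`l`. -/
lemma exists_measurable_postAct (Ahat : Matrix V V ℝ) (X : Matrix V (Fin d₀) ℝ) (α β : ℝ)
    (W0 : Ω → Matrix (Fin d₀) (Fin d) ℝ) (W : ℕ → Ω → Matrix (Fin d) (Fin d) ℝ) {l : ℕ}
    (hl : l ≤ L) :
    ∃ g : (layersUpTo d₀ d L l → ℝ) → Fin d → EuclideanSpace ℝ V,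
      Measurable g ∧ ∀ ω k, channel (postAct Ahat X α β id (W0 ω) (fun j => W j ω) 0 l) k
        = g (fun i => weights L W0 W i ω) k := by
  induction l with
  | zero =>
    refine ⟨fun z k => ∑ i, z ⟨Sum.inl (i, k), by simp [layersUpTo, layerOf]⟩ • feature X i,
      by fun_prop, fun ω k => ?_⟩
    rw [channel_postAct_zero]
    rfl
  | succ l ih =>
    obtain ⟨g, hg, hgx⟩ := ih (by omega)
    have hsub : ∀ i : layersUpTo d₀ d L l, i.1 ∈ layersUpTo d₀ d L (l + 1) := fun i => by
      have := i.2
      simp only [layersUpTo, Finset.mem_filter, Finset.mem_univ, true_and] at this ⊢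
      omega
    let r : (layersUpTo d₀ d L (l + 1) → ℝ) → layersUpTo d₀ d L l → ℝ :=
      fun z i => z ⟨i.1, hsub i⟩
    have hr : Measurable r := by fun_prop
    have hgr : ∀ k, Measurable fun z => g (r z) k := fun k =>
      (measurable_pi_apply k).comp (hg.comp hr)
    -- The index `l : Fin L` stands for the weight matrix `W (l + 1)`, which belongs to layer `l +
    -- 1`.
    refine ⟨fun z k => α • ∑ j, z ⟨Sum.inr ((⟨l, hl⟩ : Fin L), j, k),
      Finset.mem_filter.2 ⟨Finset.mem_univ _, le_rfl⟩⟩ • matCLM Ahat (g (r z) j) + β • g (r z) k,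
      by fun_prop, fun ω k => ?_⟩
    rw [channel_postAct_succ]
    simp only [hgx]
    rfl

lemma IsRandomInit.aemeasurable_postAct (h : IsRandomInit P L ν W0 W) (Ahat : Matrix V V ℝ)
    (X : Matrix V (Fin d₀) ℝ) (α β : ℝ) {l : ℕ} (hl : l ≤ L) (k : Fin d) :
    AEMeasurable (fun ω =>
      channel (postAct Ahat X α β id (W0 ω) (fun j => W j ω) 0 l) k) P := by
  obtain ⟨g, hg, hgx⟩ := exists_measurable_postAct Ahat X α β W0 W hl
  simp only [hgx]
  exact ((measurable_pi_apply k).comp hg).comp_aemeasurable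
    (aemeasurable_pi_lambda _ fun i => h.aemeasurable_weights i)

/-- The embedding after layer `l` is independent of the weights of the next layer. -/
lemma IsRandomInit.indepFun_postAct (h : IsRandomInit P L ν W0 W) (Ahat : Matrix V V ℝ)
    (X : Matrix V (Fin d₀) ℝ) (α β : ℝ) {l : ℕ} (hl : l < L) :
    IndepFun (fun ω k => channel (postAct Ahat X α β id (W0 ω) (fun j => W j ω) 0 l) k)
      (fun ω (q : Fin d × Fin d) => W (l + 1) ω q.1 q.2) P := by
  obtain ⟨g, hg, hgx⟩ := exists_measurable_postAct Ahat X α β W0 W hl.le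
  simp only [hgx]
  have hdisj : Disjoint (layersUpTo d₀ d L l) (layerEq d₀ d L (l + 1)) := by
    rw [Finset.disjoint_left]
    intro i hi hi'
    simp only [layersUpTo, layerEq, Finset.mem_filter, Finset.mem_univ, true_and] at hi hi'
    omega
  have hI := iIndepFun.indepFun_finset₀ (f := weights L W0 W) _ _ hdisj h.indep
    h.aemeasurable_weights
  exact hI.comp (φ := g) (ψ := fun (z : layerEq d₀ d L (l + 1) → ℝ) (q : Fin d × Fin d) =>
    z ⟨Sum.inr ((⟨l, hl⟩ : Fin L), q), Finset.mem_filter.2 ⟨Finset.mem_univ _, rfl⟩⟩) hg (by fun_prop)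

end RandomInit

/-! ### Limit laws and their first two moments. -/

section Laws

variable {V : Type*} [Fintype V] [DecidableEq V]

/-- The law `ρ` has finite second moment, mean `0` and covariance form `quadForm S`. -/
structure HasCovForm (ρ : Measure (EuclideanSpace ℝ V)) (S : Matrix V V ℝ) : Prop where
  memLp : MemLp id 2 ρ
  mean : ∫ y, y ∂ρ = 0
  integral_sq : ∀ a, ∫ y, (inner ℝ y a : ℝ) ^ 2 ∂ρ = quadForm S a

section CovForm

variable {ρ : Measure (EuclideanSpace ℝ V)} [IsProbabilityMeasure ρ] {S : Matrix V V ℝ}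

lemma HasCovForm.memLp_inner (h : HasCovForm ρ S) (a : EuclideanSpace ℝ V) :
    MemLp (fun y => (inner ℝ y a : ℝ)) 2 ρ :=
  h.memLp.inner_const a

lemma HasCovForm.integral_inner (h : HasCovForm ρ S) (a : EuclideanSpace ℝ V) :
    ∫ y, (inner ℝ y a : ℝ) ∂ρ = 0 := by
  have h1 := _root_.integral_inner (𝕜 := ℝ) (h.memLp.integrable (by norm_num)) a
  simp only [id] at h1
  rw [h.mean, inner_zero_right] at h1
  simpa only [real_inner_comm] using h1

/-- Polarization on basis vectors; symmetry of `S` is needed because a quadratic form sees only the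
symmetric part. -/
lemma HasCovForm.covariance_eq (h : HasCovForm ρ S) (hS : S.IsHermitian) (i j : V) :
    covariance (fun x : EuclideanSpace ℝ V => x i) (fun x : EuclideanSpace ℝ V => x j) ρ
      = S i j := by
  have hin : ∀ (i : V) (y : EuclideanSpace ℝ V),
      y i = inner ℝ y (EuclideanSpace.single i (1 : ℝ)) := fun i y => by
    simp [EuclideanSpace.inner_single_right]
  have hm : ∀ i : V, MemLp (fun y : EuclideanSpace ℝ V => y i) 2 ρ := fun i => by
    simp only [hin i]; exact h.memLp_inner _
  have h0 : ∀ i : V, ∫ y : EuclideanSpace ℝ V, y i ∂ρ = 0 := fun i => by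
    simp only [hin i]; exact h.integral_inner _
  rw [covariance_eq_sub (hm i) (hm j), h0, zero_mul, sub_zero]
  set ei : EuclideanSpace ℝ V := EuclideanSpace.single i (1 : ℝ)
  set ej : EuclideanSpace ℝ V := EuclideanSpace.single j (1 : ℝ)
  have hpol : ∀ y : EuclideanSpace ℝ V, y i * y j
      = ((inner ℝ y (ei + ej) : ℝ) ^ 2 - (inner ℝ y ei : ℝ) ^ 2 - (inner ℝ y ej : ℝ) ^ 2) / 2 :=
    fun y => by rw [hin i, hin j, inner_add_right]; ring
  have hi : ∀ a, Integrable (fun y => (inner ℝ y a : ℝ) ^ 2) ρ := fun a =>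
    (h.memLp_inner a).integrable_sq
  have hi2 : Integrable (fun y => (inner ℝ y (ei + ej) : ℝ) ^ 2 - (inner ℝ y ei : ℝ) ^ 2) ρ :=
    (hi _).sub (hi _)
  have hsymm : S j i = S i j := by simpa using hS.apply i j
  calc _ = ∫ y : EuclideanSpace ℝ V, y i * y j ∂ρ := rfl
    _ = _ := by
      simp_rw [hpol]
      rw [integral_div, integral_sub hi2 (hi _), integral_sub (hi _) (hi _), h.integral_sq, h.integral_sq, h.integral_sq]
      simp [quadForm, ei, ej, Matrix.mulVec_add, add_dotProduct, dotProduct_add,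
        Matrix.mulVec_single, hsymm]
      ring

lemma hasCovForm_multivariateGaussian (hS : S.PosSemidef) :
    HasCovForm (multivariateGaussian 0 S) S where
  memLp := IsGaussian.memLp_id _ 2 (by norm_num)
  mean := integral_id_multivariateGaussian
  integral_sq a := by
    have hm : MemLp id 2 (multivariateGaussian 0 S) := IsGaussian.memLp_id _ 2 (by norm_num)
    have h1 := covarianceBilin_multivariateGaussian (μ := 0) hS a a
    rw [covarianceBilin_apply hm] at h1
    simp only [id, integral_id_multivariateGaussian, sub_zero] at h1
    rw [quadForm, ← h1]
    congr 1; ext y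
    rw [sq, real_inner_comm]

lemma charFun_multivariateGaussian_zero (hS : S.PosSemidef) (a : EuclideanSpace ℝ V) :
    charFun (multivariateGaussian 0 S) a = Complex.exp (-(quadForm S a / 2) : ℝ) := by
  rw [charFun_multivariateGaussian hS, quadForm]
  simp

/-- The law of `β Y + α G` with `Y` and `G` independent of laws `ρ` and `κ`. -/
def combine (α β : ℝ) (ρ κ : Measure (EuclideanSpace ℝ V)) : Measure (EuclideanSpace ℝ V) :=
  (ρ.prod κ).map fun z => β • z.1 + α • z.2

variable {κ : Measure (EuclideanSpace ℝ V)} [IsProbabilityMeasure κ] {T : Matrix V V ℝ}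

instance isProbabilityMeasure_combine (α β : ℝ) : IsProbabilityMeasure (combine α β ρ κ) :=
  Measure.isProbabilityMeasure_map (by fun_prop)

lemma charFun_combine (α β : ℝ) (t : EuclideanSpace ℝ V) :
    charFun (combine α β ρ κ) t = charFun ρ (β • t) * charFun κ (α • t) := by
  rw [charFun_apply, combine, integral_map (by fun_prop) (by fun_prop), charFun_apply,
    charFun_apply, ← integral_prod_mul]
  congr 1; ext z
  rw [← Complex.exp_add, inner_add_left, real_inner_smul_left, real_inner_smul_left,
    real_inner_smul_right, real_inner_smul_right]
  push_cast
  ring_nf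

lemma HasCovForm.combine (h : HasCovForm ρ S) (h' : HasCovForm κ T) (α β : ℝ) :
    HasCovForm (combine α β ρ κ) (α ^ 2 • T + β ^ 2 • S) := by
  have hm : Measurable fun z : EuclideanSpace ℝ V × EuclideanSpace ℝ V => β • z.1 + α • z.2 := by
    fun_prop
  have m1 : MemLp (fun z : EuclideanSpace ℝ V × EuclideanSpace ℝ V => z.1) 2 (ρ.prod κ) :=
    h.memLp.comp_measurePreserving measurePreserving_fst
  have m2 : MemLp (fun z : EuclideanSpace ℝ V × EuclideanSpace ℝ V => z.2) 2 (ρ.prod κ) :=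
    h'.memLp.comp_measurePreserving measurePreserving_snd
  have h1 : ∫ z, z.1 ∂(ρ.prod κ) = 0 := by
    rw [integral_fun_fst (fun y => y), h.mean, smul_zero]
  have h2 : ∫ z, z.2 ∂(ρ.prod κ) = 0 := by
    rw [integral_fun_snd (fun y => y), h'.mean, smul_zero]
  have i1 : Integrable (fun z : EuclideanSpace ℝ V × EuclideanSpace ℝ V => β • z.1) (ρ.prod κ) :=
    (m1.integrable one_le_two).smul β
  have i2 : Integrable (fun z : EuclideanSpace ℝ V × EuclideanSpace ℝ V => α • z.2) (ρ.prod κ) :=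
    (m2.integrable one_le_two).smul α
  refine ⟨?_, ?_, fun a => ?_⟩
  · rw [ResGCN.combine, memLp_map_measure_iff aestronglyMeasurable_id hm.aemeasurable]
    exact (m1.const_smul β).add (m2.const_smul α)
  · rw [ResGCN.combine, integral_map hm.aemeasurable (by fun_prop),
      integral_add i1 i2, integral_smul, integral_smul, h1, h2]
    simp
  · rw [ResGCN.combine, integral_map hm.aemeasurable (by fun_prop)]
    -- The moment computation of a layer with a single weight `⟨z.2, a⟩`, of variance `quadForm T
    -- a`, and constant coefficient `α`.
    have hmain := memLp_and_integral_sq_sum_mul_add (p := 1) (P := ρ.prod κ)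
      (u := fun _ _ => α) (v := fun z => β * inner ℝ z.1 a) (w := fun _ z => inner ℝ z.2 a)
      (τ := quadForm T a) (fun _ => memLp_const _) ((m1.inner_const a).const_mul β)
      (fun _ => m2.inner_const a)
      (fun _ => by
        rw [integral_fun_snd (fun y => (inner ℝ y a : ℝ)), h'.integral_inner a, smul_zero])
      (fun i j => by
        rw [if_pos (Subsingleton.elim i j), ← h'.integral_sq]
        refine (integral_congr_ae (ae_of_all _ fun z => (sq _).symm)).trans ?_
        rw [integral_fun_snd (fun y => (inner ℝ y a : ℝ) ^ 2)]
        simp)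
      (indepFun_prod (X := fun y : EuclideanSpace ℝ V =>
          ((fun _ : Fin 1 => α), β * (inner ℝ y a : ℝ)))
        (Y := fun (y : EuclideanSpace ℝ V) (_ : Fin 1) => (inner ℝ y a : ℝ))
        (by fun_prop) (by fun_prop))
    have h3 := hmain.2
    simp only [mul_pow, Finset.univ_unique, Finset.sum_singleton, integral_const,
      probReal_univ, one_smul, integral_const_mul] at h3
    rw [integral_fun_fst (fun y => (inner ℝ y a : ℝ) ^ 2), h.integral_sq, probReal_univ, one_smul] at h3
    rw [quadForm_add, quadForm_smul, quadForm_smul, mul_comm (α ^ 2), ← h3]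
    congr 1; ext z
    rw [inner_add_left, real_inner_smul_left, real_inner_smul_left]
    ring

end CovForm

end Laws

/-! ### Induction on depth. -/

variable {V : Type*} [Fintype V] [DecidableEq V] {d₀ L : ℕ} {ν : ℕ → Measure ℝ}
  [∀ l, IsProbabilityMeasure (ν l)] {σw : ℝ}

/-- The second moments of the channels are given by `postCov` at every finite width. -/
lemma postAct_moments (hν : ∀ l, l ≤ L → MemLp id 2 (ν l)) (hν0 : ∀ l, l ≤ L → ∫ x, x ∂(ν l) = 0)
    (hνv : ∀ l, l ≤ L → variance id (ν l) = σw ^ 2)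
    {Ω : Type*} [MeasurableSpace Ω] {P : Measure Ω} [IsProbabilityMeasure P] {d : ℕ}
    {W0 : Ω → Matrix (Fin d₀) (Fin d) ℝ} {W : ℕ → Ω → Matrix (Fin d) (Fin d) ℝ}
    (h : IsRandomInit P L ν W0 W) {Ahat : Matrix V V ℝ} (hA : Ahat.IsHermitian)
    (X : Matrix V (Fin d₀) ℝ) (α β : ℝ) {l : ℕ} (hl : l ≤ L) (k : Fin d)
    (a : EuclideanSpace ℝ V) :
    MemLp (fun ω => (inner ℝ
        (channel (postAct Ahat X α β id (W0 ω) (fun j => W j ω) 0 l) k) a : ℝ)) 2 P ∧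
      ∫ ω, (inner ℝ (channel (postAct Ahat X α β id (W0 ω) (fun j => W j ω) 0 l) k) a : ℝ) ^ 2 ∂P
        = quadForm (postCov Ahat X α β σw l) a := by
  induction l generalizing k a with
  | zero =>
    obtain ⟨hwm, hw0, hwc⟩ := weight_moments (w := fun i k ω => W0 ω i k) (hν 0 hl) (hν0 0 hl)
      (hνv 0 hl) h.law_zero h.iIndepFun_zero k
    have hmain := memLp_and_integral_sq_sum_mul_add (P := P)
      (u := fun i _ => (inner ℝ (feature X i) a : ℝ)) (v := fun _ => 0)
      (fun i => memLp_const _) (memLp_const _) hwm hw0 hwc (indepFun_const_left _ _)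
    simp only [channel_postAct_zero, sum_inner, real_inner_smul_left]
    simp only [add_zero] at hmain
    refine ⟨hmain.1, hmain.2.trans ?_⟩
    rw [quadForm_postCov_zero]
    simp
  | succ l ih =>
    have hmain := layer_moments (hν (l + 1) hl) (hν0 (l + 1) hl) (hνv (l + 1) hl)
      (w := fun j k ω => W (l + 1) ω j k)
      (fun k a => (ih (by omega) k a).1) (fun k a => (ih (by omega) k a).2)
      (h.law_hidden (l + 1) (by omega) hl) (h.iIndepFun_hidden hl)
      (h.indepFun_postAct Ahat X α β hl) (matCLM Ahat) α β k a
    simp only [channel_postAct_succ]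
    rwa [adjoint_matCLM hA, ← quadForm_postCov_succ hA] at hmain

variable {Ω : ℕ → Type*} [∀ d, MeasurableSpace (Ω d)] {P : ∀ d, Measure (Ω d)}
  [∀ d, IsProbabilityMeasure (P d)] {W0 : ∀ d, Ω d → Matrix (Fin d₀) (Fin d) ℝ}
  {W : ∀ d, ℕ → Ω d → Matrix (Fin d) (Fin d) ℝ}

/-- The channels of `X⁽⁰⁾` are i.i.d. at every width. -/
lemma exists_convergeIID_postAct_zero (hν : MemLp id 2 (ν 0)) (hν0 : ∫ x, x ∂(ν 0) = 0)
    (hνv : variance id (ν 0) = σw ^ 2) (hW : ∀ d, IsRandomInit (P d) L ν (W0 d) (W d))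
    (Ahat : Matrix V V ℝ) (X : Matrix V (Fin d₀) ℝ) (α β : ℝ) :
    ∃ (ρ : Measure (EuclideanSpace ℝ V)) (_ : IsProbabilityMeasure ρ),
      HasCovForm ρ (postCov Ahat X α β σw 0) ∧
      ConvergeIID P (fun d k ω => channel (postAct Ahat X α β id (W0 d ω)
        (fun j => W d j ω) 0 0) k) ρ := by
  have hm : ∀ d (k : Fin d), AEMeasurable (fun ω => ∑ i, W0 d ω i k • feature X i) (P d) :=
    fun d k => Finset.aemeasurable_fun_sum _ fun i _ =>
      ((hW d).aemeasurable_zero i k).smul_const _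
  have hexp : ∀ (d m : ℕ) (e : Fin m ↪ Fin d) (t : Fin m → EuclideanSpace ℝ V),
      ∫ ω, Complex.exp ((∑ k, inner ℝ (∑ i, W0 d ω i (e k) • feature X i) (t k) : ℝ)
        * Complex.I) ∂P d
      = ∏ k, ∏ i, charFun (ν 0) (inner ℝ (feature X i) (t k) / √d₀) := fun d m e t => by
    rw [← integral_exp_sum_weights (w := fun i k ω => W0 d ω i k) (hW d).law_zero
      (hW d).iIndepFun_zero e]
    simp only [sum_inner, real_inner_smul_left]
  simp only [channel_postAct_zero]
  -- The entries of `W0` are scaled by `√d₀`, not by the width, so the law of a channel can be read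
  -- off at width `1`; the characteristic functions to be compared are then constant in `d`.
  set ρ := (P 1).map fun ω => ∑ i, W0 1 ω i 0 • feature X i with hρ
  have hρp : IsProbabilityMeasure ρ := Measure.isProbabilityMeasure_map (hm 1 0)
  obtain ⟨hwm, hw0, hwc⟩ := weight_moments (w := fun i k ω => W0 1 ω i k) hν hν0 hνv
    (hW 1).law_zero (hW 1).iIndepFun_zero 0
  refine ⟨ρ, hρp, ⟨?_, ?_, fun a => ?_⟩, ?_⟩
  · rw [hρ, memLp_map_measure_iff aestronglyMeasurable_id (hm 1 0)]
    have hi : ∀ i, MemLp (fun ω => W0 1 ω i 0 • feature X i) 2 (P 1) := fun i =>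
      (ContinuousLinearMap.toSpanSingleton ℝ (feature X i)).comp_memLp' (hwm i)
    change MemLp (fun ω => ∑ i, W0 1 ω i 0 • feature X i) 2 (P 1)
    exact memLp_finsetSum _ fun i _ => hi i
  · rw [hρ, integral_map (hm 1 0) (by fun_prop), integral_finsetSum _ fun i _ =>
      ((hwm i).integrable one_le_two).smul_const _]
    simp only [integral_smul_const, hw0, zero_smul, Finset.sum_const_zero]
  · rw [hρ, integral_map (hm 1 0) (by fun_prop), quadForm_postCov_zero]
    have hmain := memLp_and_integral_sq_sum_mul_add (P := P 1)
      (u := fun i _ => (inner ℝ (feature X i) a : ℝ)) (v := fun _ => 0)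
      (fun i => memLp_const _) (memLp_const _) hwm hw0 hwc (indepFun_const_left _ _)
    simp only [sum_inner, real_inner_smul_left]
    simp only [add_zero] at hmain
    exact hmain.2.trans (by simp)
  · refine convergeIID_of_tendsto_charFun hm fun m e t => ?_
    simp only [hexp]
    have hcf : ∀ t : EuclideanSpace ℝ V, charFun ρ t
        = ∏ i, charFun (ν 0) (inner ℝ (feature X i) t / √d₀) := fun t => by
      have h1 := hexp 1 1 (Function.Embedding.refl _) fun _ => t
      simp only [Finset.univ_unique, Finset.prod_singleton, Finset.sum_singleton] at h1
      rw [← h1, charFun_apply, hρ, integral_map (hm 1 0) (by fun_prop)]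
      rfl
    simp only [hcf]
    exact tendsto_const_nhds

/-- One layer: convergence of the embedding channels implies that of the next pre-activation and
post-activation channels. -/
lemma convergeIID_layer (hν : ∀ l, l ≤ L → MemLp id 2 (ν l))
    (hν0 : ∀ l, l ≤ L → ∫ x, x ∂(ν l) = 0)
    (hνv : ∀ l, l ≤ L → variance id (ν l) = σw ^ 2)
    (hW : ∀ d, IsRandomInit (P d) L ν (W0 d) (W d)) {Ahat : Matrix V V ℝ}
    (hA : Ahat.IsHermitian) (X : Matrix V (Fin d₀) ℝ) (α β : ℝ) {l : ℕ} (hl : l < L)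
    {ρ : Measure (EuclideanSpace ℝ V)} [IsProbabilityMeasure ρ]
    (hρ : HasCovForm ρ (postCov Ahat X α β σw l))
    (h : ConvergeIID P (fun d k ω => channel (postAct Ahat X α β id (W0 d ω)
        (fun j => W d j ω) 0 l) k) ρ) :
    ConvergeIID P (fun d k ω => channel (preAct Ahat X α β id (W0 d ω)
        (fun j => W d j ω) 0 (l + 1)) k)
      (multivariateGaussian 0 (preCov Ahat X α β σw (l + 1))) ∧
    ConvergeIID P (fun d k ω => channel (postAct Ahat X α β id (W0 d ω)
        (fun j => W d j ω) 0 (l + 1)) k)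
      (combine α β ρ (multivariateGaussian 0 (preCov Ahat X α β σw (l + 1)))) := by
  have hpost : ∀ d (k : Fin d), AEMeasurable (fun ω => channel (postAct Ahat X α β id (W0 d ω)
      (fun j => W d j ω) 0 l) k) (P d) := fun d k => (hW d).aemeasurable_postAct Ahat X α β hl.le k
  have hmom := fun d (k : Fin d) a => postAct_moments hν hν0 hνv (hW d) hA X α β hl.le k a
  have hpre : ∀ d (k : Fin d), AEMeasurable (fun ω => channel (preAct Ahat X α β id (W0 d ω)
      (fun j => W d j ω) 0 (l + 1)) k) (P d) := fun d k => by
    simp only [channel_preAct_succ]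
    exact Finset.aemeasurable_fun_sum _ fun j _ => ((hW d).aemeasurable_hidden hl j k).smul
      ((matCLM Ahat).continuous.measurable.comp_aemeasurable (hpost d j))
  have hPSD := posSemidef_preCov_succ hA X α β σw l
  have hlim := fun {m : ℕ} (e : ∀ d, Fin m ↪ Fin (m + d)) s t =>
    h.tendsto_charFun_layer hpost (fun d j a => (hmom d j a).1.integrable_sq)
      (fun a => (hρ.memLp_inner a).integrable_sq)
      (fun d j a => ((hmom d j a).2.trans (hρ.integral_sq a).symm)) (hν (l + 1) hl) (hν0 (l + 1) hl)
      (hνv (l + 1) hl) (w := fun d j k ω => W d (l + 1) ω j k)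
      (fun d => (hW d).law_hidden (l + 1) (by omega) hl)
      (fun d => (hW d).aemeasurable_hidden hl) (fun d => (hW d).iIndepFun_hidden hl)
      (fun d => (hW d).indepFun_postAct Ahat X α β hl) (matCLM Ahat) e s t
  have hg : ∀ t : EuclideanSpace ℝ V, Complex.exp
      (-(σw ^ 2 / 2 * ∫ y, (inner ℝ (matCLM Ahat y) t : ℝ) ^ 2 ∂ρ) : ℝ)
      = charFun (multivariateGaussian 0 (preCov Ahat X α β σw (l + 1))) t := fun t => by
    have hadj : ∀ y : EuclideanSpace ℝ V, (inner ℝ (matCLM Ahat y) t : ℝ)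
        = inner ℝ y (matCLM Ahat t) := fun y => by
      rw [← ContinuousLinearMap.adjoint_inner_right, adjoint_matCLM hA]
    simp only [hadj]
    rw [charFun_multivariateGaussian_zero hPSD, hρ.integral_sq, quadForm_preCov_succ hA]
    congr 3
    ring
  simp only [hg] at hlim
  refine ⟨convergeIID_of_tendsto_charFun hpre fun m e t => ?_,
    convergeIID_of_tendsto_charFun (fun d k => ?_) fun m e t => ?_⟩
  -- Testing with `s = 0` forgets the old channels and isolates the pre-activations; testing with
  -- `(β • t, α • t)` below produces the residual combination.
  · have := hlim e 0 t
    simp only [Pi.zero_apply, inner_zero_right, zero_add, charFun_zero, probReal_univ,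
      Complex.ofReal_one, one_mul] at this
    simpa only [channel_preAct_succ] using this
  · exact (hW d).aemeasurable_postAct Ahat X α β hl k
  · have := hlim e (fun k => β • t k) (fun k => α • t k)
    simp only [charFun_combine]
    refine this.congr fun d => ?_
    simp only [channel_postAct_succ, inner_add_left, real_inner_smul_left, real_inner_smul_right]
    simp only [add_comm]

/-- The covariance form is part of the induction hypothesis because the next layer needs the second
moments of the limit law to match those at finite width. -/
lemma exists_convergeIID_postAct (hν : ∀ l, l ≤ L → MemLp id 2 (ν l))
    (hν0 : ∀ l, l ≤ L → ∫ x, x ∂(ν l) = 0)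
    (hνv : ∀ l, l ≤ L → variance id (ν l) = σw ^ 2)
    (hW : ∀ d, IsRandomInit (P d) L ν (W0 d) (W d)) {Ahat : Matrix V V ℝ}
    (hA : Ahat.IsHermitian) (X : Matrix V (Fin d₀) ℝ) (α β : ℝ) {l : ℕ} (hl : l ≤ L) :
    ∃ (ρ : Measure (EuclideanSpace ℝ V)) (_ : IsProbabilityMeasure ρ),
      HasCovForm ρ (postCov Ahat X α β σw l) ∧
      ConvergeIID P (fun d k ω => channel (postAct Ahat X α β id (W0 d ω)
        (fun j => W d j ω) 0 l) k) ρ := by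
  induction l with
  | zero =>
    exact exists_convergeIID_postAct_zero (hν 0 hl) (hν0 0 hl) (hνv 0 hl) hW Ahat X α β
  | succ l ih =>
    obtain ⟨ρ, hρp, hρ, hconv⟩ := ih (by omega)
    refine ⟨_, inferInstance, ?_, (convergeIID_layer hν hν0 hνv hW hA X α β hl hρ hconv).2⟩
    have hcomb := hρ.combine (hasCovForm_multivariateGaussian
      (posSemidef_preCov_succ hA X α β σw l)) α β
    rw [preCov_succ, smul_smul, ← postCov] at hcomb
    rwa [preCov_succ]

end ResGCN
end

theorem mainTheorem6 {V : Type*} [Fintype V] [DecidableEq V] (G : SimpleGraph V)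
    [DecidableRel G.Adj] {d₀ : ℕ} (X : Matrix V (Fin d₀) ℝ) (α β σw : ℝ) (L : ℕ)
    (ν : ℕ → Measure ℝ) [∀ l, IsProbabilityMeasure (ν l)]
    (hν_memLp : ∀ l, l ≤ L → MemLp id 2 (ν l)) (hν_mean : ∀ l, l ≤ L → ∫ x, x ∂(ν l) = 0)
    (hν_var : ∀ l, l ≤ L → variance id (ν l) = σw ^ 2)
    {Ω : ℕ → Type*} [∀ d, MeasurableSpace (Ω d)] (P : ∀ d, Measure (Ω d))
    [∀ d, IsProbabilityMeasure (P d)]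
    (W0 : ∀ d, Ω d → Matrix (Fin d₀) (Fin d) ℝ)
    (W : ∀ d, ℕ → Ω d → Matrix (Fin d) (Fin d) ℝ)
    (hW : ∀ d, ResGCN.IsRandomInit (P d) L ν (W0 d) (W d)) :
    (∀ l, 1 ≤ l → l ≤ L →
      ResGCN.ConvergeIID P
        (fun d k ω => ResGCN.channel (ResGCN.preAct (ResGCN.normAdj G) X α β id (W0 d ω)
          (fun j => W d j ω) 0 l) k)
        (multivariateGaussian 0 (ResGCN.preCov (ResGCN.normAdj G) X α β σw l))) ∧
    (∀ l, l ≤ L →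
      ∃ (ρ : Measure (EuclideanSpace ℝ V)) (_ : IsProbabilityMeasure ρ),
        MemLp id 2 ρ ∧ (∫ x, x ∂ρ = 0) ∧
        (∀ i j : V, covariance (fun x : EuclideanSpace ℝ V => x i)
          (fun x : EuclideanSpace ℝ V => x j) ρ
            = ResGCN.postCov (ResGCN.normAdj G) X α β σw l i j) ∧
        ResGCN.ConvergeIID P
          (fun d k ω => ResGCN.channel (ResGCN.postAct (ResGCN.normAdj G) X α β id (W0 d ω)
            (fun j => W d j ω) 0 l) k)
          ρ) := by
  have hA := ResGCN.isHermitian_normAdj G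
  refine ⟨fun l hl1 hl => ?_, fun l hl => ?_⟩
  · obtain ⟨l, rfl⟩ := Nat.exists_eq_add_of_le' hl1
    obtain ⟨ρ, hρp, hρ, hconv⟩ := ResGCN.exists_convergeIID_postAct hν_memLp hν_mean hν_var hW hA
      X α β (l := l) (by omega)
    exact (ResGCN.convergeIID_layer hν_memLp hν_mean hν_var hW hA X α β hl hρ hconv).1
  · obtain ⟨ρ, hρp, hρ, hconv⟩ := ResGCN.exists_convergeIID_postAct hν_memLp hν_mean hν_var hW hA
      X α β hl
    exact ⟨ρ, hρp, hρ.memLp, hρ.mean,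
      hρ.covariance_eq (ResGCN.posSemidef_postCov hA X α β σw l).isHermitian, hconv⟩
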